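/- Let $n\ge 1$ and let $\Omega'_n$ be a closed disk with $n$ labelled marked points in its interior and one marked point on its boundary. An arc is an isotopy class (fixing the marked points) of simple arcs with endpoints at marked points, where arcs that are null-homotopic or parallel to the boundary curve are not counted. A triangulation of $\Omega'_n$ is a maximal collection of distinct arcs that are pairwise disjoint except possibly at their endpoints; loops, multiple edges and self-folded triangles are allowed. Equivalently, up to homeomorphism, it is a gluing of finitely many oriented triangles along sides, compatible with the orientations, that yields a disk with exactly one unglued side, whose vertices are precisely the boundary marked point and the $n$ labelled interior points. The modular simultaneous flip graph $\mathcal{MF}^s(\Omega'_n)$ has as vertices the triangulations of $\Omega'_n$ up to homeomorphisms of the disk that fix every marked point. Two distinct vertices are joined by an edge if they are represented by triangulations that differ by finitely many flips supported on quadrilaterals with pairwise disjoint interiors; here a flip replaces an arc that lies on two different triangles by the other diagonal of the quadrilateral they form. Then $\mathcal{MF}^s(\Omega'_n)$ is connected, its diameter is finite, and $$\operatorname{diam}\bigl(\mathcal{MF}^s(\Omega'_n)\bigr) < 1000\,\bigl(\log(n+1)\bigr)^2 .$$ The same holds if only orientation-preserving homeomorphisms are used to identify triangulations. -/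

import Mathlib

/-! Triangulations of a disk with `n` labelled interior marked points and one marked point on the
boundary, up to homeomorphism, as labelled combinatorial maps (gluings of oriented triangles), and
the graph of simultaneous flips on them. -/

namespace FlipDisk

open Equiv

/-- The number of orbits (cycles, including fixed points) of a permutation. -/
noncomputable def orbitCount {D : Type} (f : Perm D) : ℕ :=
  Nat.card (Quotient (Perm.SameCycle.setoid f))

/-- A triangulation of the disk with interior marked points labelled by `Fin n` and one boundary
marked point (labelled `none`), with set `D` of oriented edges ("darts"). A dart lies on the
boundary of the face on its left. Loops, multiple edges and self-folded triangles are allowed.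
The disk is closed up to a sphere by one further face, whose only side is the dart `root`, so that
`root` and `opp root` are the two orientations of the boundary curve of the disk. -/
structure Triangulation (n : ℕ) (D : Type) where
  /-- the next dart along the boundary of the face on the left -/
  next : Perm D
  /-- the same edge with the opposite orientation -/
  opp : Perm D
  /-- the boundary curve, with the complement of the disk on its left -/
  root : D
  /-- the label of the initial point of a dart -/
  vert : D → Option (Fin n)
  opp_opp : ∀ d, opp (opp d) = d
  opp_ne : ∀ d, opp d ≠ d
  /-- the outer face has exactly one side -/
  next_root : next root = root
  /-- every other face is a triangle -/
  next_ne : ∀ d, d ≠ root → next d ≠ d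
  next_next_next : ∀ d, next (next (next d)) = d
  /-- the surface is connected -/
  connected : ∀ d d', ∃ g ∈ Subgroup.closure ({next, opp} : Set (Perm D)), g d = d'
  /-- Vertices are the orbits of `next * opp`, which turns a dart about its initial point; distinct
  vertices have distinct labels -/
  vert_eq_iff : ∀ d d', vert d = vert d' ↔ (next * opp).SameCycle d d'
  /-- every marked point is a vertex -/
  vert_surjective : Function.Surjective vert
  /-- the boundary curve is based at the boundary marked point -/
  vert_root : vert root = none
  /-- Euler's formula (vertices + faces = edges + 2): the closed-up surface is a sphere -/
  euler : orbitCount (next * opp) + orbitCount next = orbitCount opp + 2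

variable {n : ℕ} {D E F : Type}

/-- An orientation-preserving homeomorphism that fixes every marked point carries `T` to `T'`. -/
def OrientedIso (T : Triangulation n D) (T' : Triangulation n E) : Prop :=
  ∃ e : D ≃ E, ∀ d, T'.next (e d) = e (T.next d) ∧ T'.opp (e d) = e (T.opp d) ∧
    T'.vert (e d) = T.vert d

/-- An orientation-reversing homeomorphism that fixes every marked point carries `T` to `T'`. Here
`e d` is the image of the dart `d` run backwards, which has the image of the left face of `d` on
its left. -/
def ReversingIso (T : Triangulation n D) (T' : Triangulation n E) : Prop :=
  ∃ e : D ≃ E, ∀ d, T'.next (e d) = e (T.next.symm d) ∧ T'.opp (e d) = e (T.opp d) ∧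
    T'.vert (e d) = T.vert (T.opp d)

theorem OrientedIso.refl (T : Triangulation n D) : OrientedIso T T :=
  ⟨Equiv.refl D, fun _ => ⟨rfl, rfl, rfl⟩⟩

theorem OrientedIso.symm {T : Triangulation n D} {T' : Triangulation n E}
    (h : OrientedIso T T') : OrientedIso T' T := by
  obtain ⟨e, h⟩ := h
  refine ⟨e.symm, fun d => ?_⟩
  obtain ⟨d, rfl⟩ := e.surjective d
  obtain ⟨h1, h2, h3⟩ := h d
  simp [h1, h2, h3]

theorem OrientedIso.trans {T : Triangulation n D} {T' : Triangulation n E}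
    {T'' : Triangulation n F} (h : OrientedIso T T') (h' : OrientedIso T' T'') :
    OrientedIso T T'' := by
  obtain ⟨e, h⟩ := h
  obtain ⟨e', h'⟩ := h'
  exact ⟨e.trans e', fun d => by simp [h, h']⟩

theorem ReversingIso.symm {T : Triangulation n D} {T' : Triangulation n E}
    (h : ReversingIso T T') : ReversingIso T' T := by
  obtain ⟨e, h⟩ := h
  refine ⟨e.symm, fun d => ?_⟩
  obtain ⟨d, rfl⟩ := e.surjective d
  have h1 := (h (T.next d)).1
  obtain ⟨-, h2, -⟩ := h d
  have h3 := (h (T.opp d)).2.2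
  rw [Equiv.symm_apply_apply] at h1
  rw [T.opp_opp] at h3
  have h4 : T'.next.symm (e d) = e (T.next d) := by rw [← h1, Equiv.symm_apply_apply]
  exact ⟨by simp [h4], by simp [h2], by simp [h2, h3]⟩

theorem ReversingIso.trans {T : Triangulation n D} {T' : Triangulation n E}
    {T'' : Triangulation n F} (h : ReversingIso T T') (h' : ReversingIso T' T'') :
    OrientedIso T T'' := by
  obtain ⟨e, h⟩ := h
  obtain ⟨e', h'⟩ := h'
  refine ⟨e.trans e', fun d => ?_⟩
  have h1 := (h (T.next d)).1
  rw [Equiv.symm_apply_apply] at h1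
  refine ⟨?_, by simp [h, h'], by simp [h, h', T.opp_opp]⟩
  simp [h', ← h1]

theorem OrientedIso.trans_reversing {T : Triangulation n D} {T' : Triangulation n E}
    {T'' : Triangulation n F} (h : OrientedIso T T') (h' : ReversingIso T' T'') :
    ReversingIso T T'' := by
  obtain ⟨e, h⟩ := h
  obtain ⟨e', h'⟩ := h'
  refine ⟨e.trans e', fun d => ?_⟩
  have h1 := (h (T.next.symm d)).1
  rw [Equiv.apply_symm_apply] at h1
  refine ⟨?_, by simp [h, h'], by simp [h, h']⟩
  simp [h', ← h1]

theorem ReversingIso.trans_oriented {T : Triangulation n D} {T' : Triangulation n E}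
    {T'' : Triangulation n F} (h : ReversingIso T T') (h' : OrientedIso T' T'') :
    ReversingIso T T'' :=
  (h'.symm.trans_reversing h.symm).symm

/-- Triangulations of the disk with `n` labelled interior marked points, with any finite number of
edges. -/
def Tri (n : ℕ) : Type := Σ m : ℕ, Triangulation n (Fin m)

/-- Being related by an orientation-preserving homeomorphism that fixes every marked point. -/
def orientedSetoid (n : ℕ) : Setoid (Tri n) where
  r T T' := OrientedIso T.2 T'.2
  iseqv := ⟨fun T => OrientedIso.refl T.2, fun h => h.symm, fun h h' => h.trans h'⟩

/-- Being related by a homeomorphism, of either kind, that fixes every marked point. -/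
def homeoSetoid (n : ℕ) : Setoid (Tri n) where
  r T T' := OrientedIso T.2 T'.2 ∨ ReversingIso T.2 T'.2
  iseqv := by
    refine ⟨fun T => Or.inl (OrientedIso.refl T.2), ?_, ?_⟩
    · rintro _ _ (h | h)
      · exact Or.inl h.symm
      · exact Or.inr h.symm
    · rintro _ _ _ (h | h) (h' | h')
      · exact Or.inl (h.trans h')
      · exact Or.inr (h.trans_reversing h')
      · exact Or.inr (h.trans_oriented h')
      · exact Or.inl (h.trans h')

/-- `T'` arises from `T` by simultaneously flipping the arcs whose darts form the set `S`.
The flipped arcs are interior arcs, and no triangle has two sides in `S`: so each of them is the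
diagonal of a quadrilateral made of two different triangles, and these quadrilaterals have disjoint
interiors. If `d ∈ S` lies in the triangle `(d, a, b)` and `opp d` in `(opp d, c, f)`, then these
two triangles become `(a, d, f)` and `(c, opp d, b)`, where `d` now runs from the initial point of
`b` to that of `f`. -/
def FlipAlong (S : Set D) (T T' : Triangulation n D) : Prop :=
  T.root ∉ S ∧
  (∀ d ∈ S, T.opp d ∈ S ∧ T.next d ∉ S ∧ T.next (T.next d) ∉ S) ∧
  T'.opp = T.opp ∧
  (∀ d ∈ S, T'.next (T.next d) = d ∧ T'.next d = T.next (T.next (T.opp d)) ∧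
    T'.next (T.next (T.next d)) = T.next (T.opp d)) ∧
  (∀ d, d ∉ S → T.next d ∉ S → T.next (T.next d) ∉ S → T'.next d = T.next d) ∧
  (∀ d ∈ S, T'.vert d = T.vert (T.next (T.next d))) ∧
  (∀ d, d ∉ S → T'.vert d = T.vert d)

/-- The simultaneous flip graph on the classes of triangulations for an equivalence relation `s`:
two different classes are adjacent when they have representatives that differ by one simultaneous
flip. -/
def flipGraph (s : Setoid (Tri n)) : SimpleGraph (Quotient s) :=
  SimpleGraph.fromRel fun X Y => ∃ (m : ℕ) (S : Set (Fin m)) (T T' : Triangulation n (Fin m)),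
    FlipAlong S T T' ∧ X = Quotient.mk s ⟨m, T⟩ ∧ Y = Quotient.mk s ⟨m, T'⟩

/-- The modular simultaneous flip graph: triangulations up to homeomorphisms fixing every marked
point. -/
def modularFlipGraph (n : ℕ) : SimpleGraph (Quotient (homeoSetoid n)) :=
  flipGraph (homeoSetoid n)

/-- The modular simultaneous flip graph in which only orientation-preserving homeomorphisms are
used to identify triangulations. -/
def orientedModularFlipGraph (n : ℕ) : SimpleGraph (Quotient (orientedSetoid n)) :=
  flipGraph (orientedSetoid n)

end FlipDisk

/-! Cutting the disk along suitable arcs turns a triangulation into a triangulated polygon, whose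
dual tree, rooted at the boundary curve, is a binary tree with `2 * n` leaves. Flips in the polygon
are rotations of this tree, and simultaneous flips are simultaneous rotations. Three simultaneous
rotations collapse enough pairs of sibling leaves to shrink a tree by the factor `5 / 6`; hence
logarithmically many simultaneous rotations, say `j`, turn it into a comb, and `2 * j` turn it into
any other tree with the same number of leaves.

In a suitable shape every interior marked point is joined to the boundary point by an arc, a spoke.
Cut along the spokes instead, the disk becomes a star, which is determined by its tree and the
order in which the spokes leave the boundary point. A star can be given a shape with arcs around
its interior points such that replacing some of the spokes by other arcs of the same triangulation
moves these points to the end of the order. So a change of shape and one such re-cutting perform a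
pass of a radix sort, and after `⌈log₂ n⌉ + 1` passes the order is the standard one, whatever the
triangulation was at the start. -/

namespace FlipDisk

open Equiv FreeMagma

universe u

/-! ### Simultaneous rotations of binary trees -/

section Trees

variable {α β : Type u}

/-- One simultaneous rotation of a binary tree (an element of the free magma): the associativity law
is applied at pairwise disjoint pairs of adjacent nodes. -/
inductive SimRot : FreeMagma α → FreeMagma α → Prop
  | of (a : α) : SimRot (of a) (of a)
  | mul {a a' b b' : FreeMagma α} : SimRot a a' → SimRot b b' → SimRot (a * b) (a' * b')
  | left {a a' b b' c c' : FreeMagma α} : SimRot a a' → SimRot b b' → SimRot c c' →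
      SimRot (a * (b * c)) (a' * b' * c')
  | right {a a' b b' c c' : FreeMagma α} : SimRot a a' → SimRot b b' → SimRot c c' →
      SimRot (a * b * c) (a' * (b' * c'))

theorem SimRot.refl (t : FreeMagma α) : SimRot t t := by
  induction t with
  | ih1 a => exact .of a
  | ih2 l r hl hr => exact .mul hl hr

theorem SimRot.symm {t u : FreeMagma α} (h : SimRot t u) : SimRot u t := by
  induction h with
  | of a => exact .of a
  | mul _ _ ha hb => exact .mul ha hb
  | left _ _ _ ha hb hc => exact .right ha hb hc
  | right _ _ _ ha hb hc => exact .left ha hb hc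

theorem SimRot.toFreeSemigroup_eq {t u : FreeMagma α} (h : SimRot t u) :
    toFreeSemigroup t = toFreeSemigroup u := by
  induction h <;> simp only [map_mul, mul_assoc, *]

theorem SimRot.lift {t u : FreeMagma α} (h : SimRot t u) (f : α → FreeMagma β) :
    SimRot (FreeMagma.lift f t) (FreeMagma.lift f u) := by
  induction h with
  | of a => exact .refl _
  | mul _ _ ha hb => exact .mul ha hb
  | left _ _ _ ha hb hc => exact .left ha hb hc
  | right _ _ _ ha hb hc => exact .right ha hb hc

/-- The mirror image of a binary tree. -/
def mirror : FreeMagma α → FreeMagma α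
  | .of a => of a
  | l * r => mirror r * mirror l

theorem mirror_mirror (t : FreeMagma α) : mirror (mirror t) = t := by
  induction t with
  | ih1 a => rfl
  | ih2 l r hl hr => simp only [mirror, hl, hr]

theorem length_mirror (t : FreeMagma α) : (mirror t).length = t.length := by
  induction t with
  | ih1 a => rfl
  | ih2 l r hl hr => simp only [mirror, FreeMagma.length, hl, hr, add_comm]

theorem SimRot.mirror {t u : FreeMagma α} (h : SimRot t u) : SimRot (mirror t) (mirror u) := by
  induction h with
  | of a => exact .of a
  | mul _ _ ha hb => exact .mul hb ha
  | left _ _ _ ha hb hc => exact .right hc hb ha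
  | right _ _ _ ha hb hc => exact .left hc hb ha

/-- A sequence of `k` simultaneous rotations. -/
def SimRots : ℕ → FreeMagma α → FreeMagma α → Prop
  | 0, t, u => t = u
  | k + 1, t, u => ∃ s, SimRot t s ∧ SimRots k s u

theorem SimRot.simRots {t u : FreeMagma α} (h : SimRot t u) : SimRots 1 t u := ⟨u, h, rfl⟩

theorem SimRots.refl (k : ℕ) (t : FreeMagma α) : SimRots k t t := by
  induction k with
  | zero => rfl
  | succ k ih => exact ⟨t, .refl t, ih⟩

theorem SimRots.trans {j k : ℕ} {s t u : FreeMagma α} (h : SimRots j s t) (h' : SimRots k t u) :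
    SimRots (j + k) s u := by
  induction j generalizing s with
  | zero => cases h; rwa [zero_add]
  | succ j ih =>
    obtain ⟨r, hr, hrt⟩ := h
    rw [Nat.add_right_comm]
    exact ⟨r, hr, ih hrt⟩

theorem SimRots.symm {k : ℕ} {t u : FreeMagma α} (h : SimRots k t u) : SimRots k u t := by
  induction k generalizing t with
  | zero => exact Eq.symm h
  | succ k ih =>
    obtain ⟨s, hs, hsu⟩ := h
    exact (ih hsu).trans hs.symm.simRots

theorem SimRots.toFreeSemigroup_eq {k : ℕ} {t u : FreeMagma α} (h : SimRots k t u) :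
    toFreeSemigroup t = toFreeSemigroup u := by
  induction k generalizing t with
  | zero => exact congrArg _ h
  | succ k ih =>
    obtain ⟨s, hs, hsu⟩ := h
    exact hs.toFreeSemigroup_eq.trans (ih hsu)

theorem SimRots.map {k : ℕ} {t u : FreeMagma α} (h : SimRots k t u)
    {f : FreeMagma α → FreeMagma β} (hf : ∀ {t u}, SimRot t u → SimRot (f t) (f u)) :
    SimRots k (f t) (f u) := by
  induction k generalizing t with
  | zero => exact congrArg f h
  | succ k ih =>
    obtain ⟨s, hs, hsu⟩ := h
    exact ⟨f s, hf hs, ih hsu⟩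

theorem SimRots.mul {k : ℕ} {t t' u u' : FreeMagma α} (h : SimRots k t u) (h' : SimRots k t' u') :
    SimRots k (t * t') (u * u') := by
  induction k generalizing t t' with
  | zero => exact congrArg₂ _ h h'
  | succ k ih =>
    obtain ⟨s, hs, hsu⟩ := h
    obtain ⟨s', hs', hsu'⟩ := h'
    exact ⟨s * s', .mul hs hs', ih hsu hsu'⟩

/-- A leaf or a pair of sibling leaves. -/
def small : α ⊕ α × α → FreeMagma α
  | .inl a => of a
  | .inr (a, b) => of a * of b

/-- Two simultaneous rotations turn `t` into a tree from which `s` arises by collapsing pairs of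
sibling leaves. -/
def ContractsTo (t : FreeMagma α) (s : FreeMagma (α ⊕ α × α)) : Prop :=
  SimRots 2 t (lift small s)

theorem contractsTo_of (a : α) : ContractsTo (of a) (of (.inl a)) := SimRots.refl 2 _

theorem contractsTo_pair (a b : α) : ContractsTo (of a * of b) (of (.inr (a, b))) :=
  SimRots.refl 2 _

namespace ContractsTo

variable {t t' : FreeMagma α} {s s' : FreeMagma (α ⊕ α × α)}

theorem mul (h : ContractsTo t s) (h' : ContractsTo t' s') : ContractsTo (t * t') (s * s') :=
  SimRots.mul h h'

theorem pair_left (a b : α) (h : ContractsTo t s) :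
    ContractsTo (of a * (of b * t)) (of (.inr (a, b)) * s) := by
  obtain ⟨x, hx, y, hy, rfl⟩ := h
  exact ⟨_, .left (.of a) (.of b) hx, _, .mul (.refl _) hy, rfl⟩

theorem pair_zigzag (a b c : α) (h : ContractsTo t s) :
    ContractsTo (of a * (of b * t * of c)) (of (.inr (a, b)) * (s * of (.inl c))) := by
  obtain ⟨x, hx, y, hy, rfl⟩ := h
  exact ⟨_, .mul (.of a) (.right (.of b) hx (.of c)), _,
    .left (.of a) (.of b) (.mul hy (.of c)), rfl⟩

theorem pair_right (b c : α) (h : ContractsTo t s) :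
    ContractsTo (t * of b * of c) (s * of (.inr (b, c))) := by
  obtain ⟨x, hx, y, hy, rfl⟩ := h
  exact ⟨_, .right hx (.of b) (.of c), _, .mul hy (.refl _), rfl⟩

theorem exists_mirror (h : ContractsTo t s) :
    ∃ s', ContractsTo (mirror t) s' ∧ s'.length = s.length := by
  refine ⟨mirror (FreeMagma.map (Sum.map id Prod.swap) s), ?_, ?_⟩
  · have hs : lift small (mirror (FreeMagma.map (Sum.map id Prod.swap) s)) =
        mirror (lift small s) := by
      clear h
      induction s with
      | ih1 a => rcases a with a | ⟨a, b⟩ <;> rfl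
      | ih2 l r hl hr => simp only [map_mul, mirror, hl, hr]
    simpa only [ContractsTo, hs] using SimRots.map h SimRot.mirror
  · rw [length_mirror, ← length_toFreeSemigroup, toFreeSemigroup_map, FreeSemigroup.length_map,
      length_toFreeSemigroup]

end ContractsTo

/-- Two simultaneous rotations make a constant proportion of the leaves of `t` collapsible. The
summand `2` makes up for a leaf that is attached to `t` without being collapsed. -/
def Contractible (t : FreeMagma α) : Prop :=
  ∃ s, ContractsTo t s ∧ 6 * s.length + 2 ≤ 5 * t.length

theorem Contractible.of_mirror {t : FreeMagma α} (h : Contractible (mirror t)) :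
    Contractible t := by
  obtain ⟨s, hs, hlen⟩ := h
  obtain ⟨s', hs', hs's⟩ := hs.exists_mirror
  rw [mirror_mirror] at hs'
  rw [length_mirror] at hlen
  exact ⟨s', hs', hs's ▸ hlen⟩

theorem contractible_of_mul_mul_of (a c : α) (l r : FreeMagma α)
    (ih : ∀ x y : FreeMagma α, (x * y).length ≤ (l * r).length → Contractible (x * y)) :
    Contractible (of a * (l * r * of c)) := by
  rcases l with b | ⟨l₁, l₂⟩ <;> rcases r with d | ⟨r₁, r₂⟩ <;>
    simp only [mul_eq, FreeMagma.length] at ih ⊢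
  · exact ⟨_, (contractsTo_of a).mul ((contractsTo_pair b d).mul (contractsTo_of c)), by simp⟩
  · obtain ⟨s, hs, hlen⟩ := ih r₁ r₂ (by omega)
    exact ⟨_, hs.pair_zigzag a b c, by simp only [FreeMagma.length] at hlen ⊢; omega⟩
  · obtain ⟨s, hs, hlen⟩ := ih l₁ l₂ (by omega)
    exact ⟨_, (contractsTo_of a).mul (hs.pair_right d c),
      by simp only [FreeMagma.length] at hlen ⊢; omega⟩
  · obtain ⟨s, hs, hlen⟩ := ih l₁ l₂ (by omega)
    obtain ⟨s', hs', hlen'⟩ := ih r₁ r₂ (by omega)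
    exact ⟨_, (contractsTo_of a).mul ((hs.mul hs').mul (contractsTo_of c)),
      by simp only [FreeMagma.length] at hlen hlen' ⊢; omega⟩

theorem contractible_of_mul_mul (a : α) (l r : FreeMagma α)
    (ih : ∀ x y : FreeMagma α, (x * y).length ≤ (l * r).length → Contractible (x * y)) :
    Contractible (of a * (l * r)) := by
  rcases r with c | ⟨r₁, r₂⟩ <;> rcases l with b | ⟨l₁, l₂⟩ <;>
    simp only [mul_eq, FreeMagma.length] at ih ⊢
  · exact ⟨_, (contractsTo_of a).mul (contractsTo_pair b c), by simp⟩
  · exact contractible_of_mul_mul_of a c l₁ l₂ fun x y h => ih x y (h.trans (Nat.le_succ _))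
  · obtain ⟨s, hs, hlen⟩ := ih r₁ r₂ (by omega)
    exact ⟨_, hs.pair_left a b, by simp only [FreeMagma.length] at hlen ⊢; omega⟩
  · obtain ⟨s, hs, hlen⟩ := ih l₁ l₂ (by omega)
    obtain ⟨s', hs', hlen'⟩ := ih r₁ r₂ (by omega)
    exact ⟨_, (contractsTo_of a).mul (hs.mul hs'),
      by simp only [FreeMagma.length] at hlen hlen' ⊢; omega⟩

theorem contractible_mul (l r : FreeMagma α) : Contractible (l * r) := by
  induction hk : (l * r).length using Nat.strong_induction_on generalizing l r with
  | _ k ih =>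
    subst hk
    replace ih (x y : FreeMagma α) (h : (x * y).length < (l * r).length) : Contractible (x * y) :=
      ih _ h x y rfl
    rcases l with a | ⟨l₁, l₂⟩ <;> rcases r with b | ⟨r₁, r₂⟩ <;>
      simp only [mul_eq, FreeMagma.length] at ih ⊢
    · exact ⟨_, contractsTo_pair a b, by simp⟩
    · exact contractible_of_mul_mul a r₁ r₂ fun x y h => ih x y <| by
        simp only [FreeMagma.length] at h; omega
    · refine .of_mirror <| contractible_of_mul_mul b (mirror l₂) (mirror l₁) fun x y h =>
        ih x y ?_
      simp only [FreeMagma.length, length_mirror] at h; omega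
    · have := l₁.length_pos
      have := r₁.length_pos
      obtain ⟨s, hs, hlen⟩ := ih l₁ l₂ (by omega)
      obtain ⟨s', hs', hlen'⟩ := ih r₁ r₂ (by omega)
      exact ⟨_, hs.mul hs', by simp only [FreeMagma.length] at hlen hlen' ⊢; omega⟩

/-- The tree with a given word of leaves all of whose nodes lie on its right branch. -/
def comb (w : FreeSemigroup α) : FreeMagma α :=
  FreeSemigroup.recOnMul w of fun a _ _ t => of a * t

theorem simRot_lift_small_comb (w : FreeSemigroup (α ⊕ α × α)) :
    SimRot (lift small (comb w)) (comb (FreeSemigroup.lift (toFreeSemigroup ∘ small) w)) := by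
  induction w with
  | ih1 a => rcases a with a | ⟨a, b⟩ <;> exact .refl _
  | ih2 a w _ h =>
    rw [FreeSemigroup.lift_of_mul]
    rcases a with a | ⟨a, b⟩
    · exact .mul (.of a) h
    · exact .right (.of a) (.of b) h

theorem simRots_comb (j : ℕ) (t : FreeMagma α) (h : t.length * 5 ^ j ≤ 6 ^ j) :
    SimRots (3 * j) t (comb (toFreeSemigroup t)) := by
  induction j generalizing α with
  | zero =>
    rcases t with a | ⟨l, r⟩
    · rfl
    · have := l.length_pos
      have := r.length_pos
      simp only [FreeMagma.length] at h
      omega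
  | succ j ih =>
    rcases t with a | ⟨l, r⟩
    · exact SimRots.refl _ _
    obtain ⟨s, hs, hlen⟩ := contractible_mul l r
    have hleaves : toFreeSemigroup (l * r) =
        FreeSemigroup.lift (toFreeSemigroup ∘ small) (toFreeSemigroup s) := by
      rw [SimRots.toFreeSemigroup_eq hs]
      exact DFunLike.congr_fun (hom_ext rfl : toFreeSemigroup.comp (lift small) =
        (FreeSemigroup.lift (toFreeSemigroup ∘ small)).comp toFreeSemigroup) s
    have hcomb : SimRots (3 * j) s (comb (toFreeSemigroup s)) := ih s <| by
      have hlt : 6 * s.length * 5 ^ j ≤ 5 * (l * r).length * 5 ^ j :=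
        Nat.mul_le_mul_right _ (by omega)
      rw [mul_eq, pow_succ, pow_succ] at h
      linarith
    have := (SimRots.trans hs (hcomb.map fun h => h.lift small)).trans
      (simRot_lift_small_comb _).simRots
    rwa [← hleaves, show 2 + 3 * j + 1 = 3 * (j + 1) by ring] at this

theorem simRots_of_toFreeSemigroup_eq (j : ℕ) (t u : FreeMagma α)
    (htu : toFreeSemigroup t = toFreeSemigroup u) (h : t.length * 5 ^ j ≤ 6 ^ j) :
    SimRots (6 * j) t u := by
  have hu : u.length * 5 ^ j ≤ 6 ^ j := by
    rwa [← length_toFreeSemigroup, ← htu, length_toFreeSemigroup]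
  have := (simRots_comb j t h).trans (htu ▸ (simRots_comb j u hu).symm)
  rwa [show 3 * j + 3 * j = 6 * j by ring] at this

theorem toFreeSemigroup_eq_of_length_eq [Subsingleton α] {t u : FreeMagma α}
    (h : t.length = u.length) : toFreeSemigroup t = toFreeSemigroup u := by
  rw [← length_toFreeSemigroup, ← length_toFreeSemigroup] at h
  refine FreeSemigroup.ext (Subsingleton.elim _ _) (List.ext_get (Nat.succ_injective h) ?_)
  exact fun _ _ _ => Subsingleton.elim _ _

end Trees

/-! ### Gluings -/

section Perm

variable {D : Type}

theorem rel_of_sameCycle {f : Perm D} {r : D → D → Prop} (hr : Equivalence r)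
    (h : ∀ d, r d (f d)) {d d' : D} (hd : f.SameCycle d d') : r d d' := by
  obtain ⟨i, rfl⟩ := hd
  induction i using Int.induction_on with
  | zero => exact hr.refl d
  | succ i ih => rw [add_comm, zpow_add, zpow_one]; exact hr.trans ih (h _)
  | pred i ih =>
    rw [sub_eq_add_neg, add_comm, zpow_add, zpow_neg_one]
    refine hr.trans ih (hr.symm ?_)
    simpa using h (f⁻¹ ((f ^ (-i : ℤ)) d))

theorem mem_iff_of_forall_ne [Finite D] {f : Perm D} {C : Set D} {x : D}
    (h : ∀ y, f.SameCycle x y → y ≠ x → (f y ∈ C ↔ y ∈ C)) : f x ∈ C ↔ x ∈ C := by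
  have key (C : Set D) (hC : ∀ y, f.SameCycle x y → y ≠ x → (f y ∈ C ↔ y ∈ C)) (hx : x ∈ C) :
      f x ∈ C := by
    by_contra hfx
    set O := C ∩ {y | f.SameCycle x y}
    have hmaps : Set.MapsTo f.symm O O := by
      rintro y ⟨hy, hxy⟩
      have hxy' : f.SameCycle x (f.symm y) := Perm.sameCycle_symm_apply_right.2 hxy
      refine ⟨(hC _ hxy' fun hyx => hfx ?_).1 (by rwa [apply_symm_apply]), hxy'⟩
      rwa [← hyx, apply_symm_apply]
    obtain ⟨y, ⟨hy, -⟩, hyx⟩ := (((Set.toFinite O).injOn_iff_bijOn_of_mapsTo hmaps).1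
      f.symm.injective.injOn).surjOn ⟨hx, .refl f x⟩
    exact hfx (by rwa [← hyx, apply_symm_apply])
  exact ⟨fun hfx => by_contra fun hx => key Cᶜ (fun y hy hne => not_congr (h y hy hne)) hx hfx,
    key C h⟩

theorem orbitCount_eq_of_labels {A : Type} {f : Perm D} {v : D → A}
    (hv : ∀ d d', v d = v d' ↔ f.SameCycle d d') (hs : Function.Surjective v) :
    orbitCount f = Nat.card A := by
  refine Nat.card_congr (Equiv.ofBijective (Quotient.lift v fun d d' h => (hv d d').2 h) ⟨?_, ?_⟩)
  · rintro ⟨d⟩ ⟨d'⟩ h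
    exact Quotient.sound ((hv d d').1 h)
  · exact hs.of_comp (f := Quotient.lift v _) (g := Quotient.mk _)

theorem card_orbits_zpowers (f : Perm D) :
    Nat.card (Quotient (MulAction.orbitRel (Subgroup.zpowers f) D)) = orbitCount f := by
  refine Nat.card_congr (Quotient.congrRight fun x y => ?_)
  rw [MulAction.orbitRel_apply, MulAction.mem_orbit_symm]
  exact Subgroup.exists_zpowers (p := fun g : Subgroup.zpowers f => g • x = y)

theorem fixedBy_zpowers {p : ℕ} [Fact p.Prime] {f : Perm D} (hf : orderOf f = p)
    {g : Subgroup.zpowers f} (hg : g ≠ 1) : MulAction.fixedBy D g = Function.fixedPoints f := by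
  have htop := zpowers_eq_top_of_prime_card ((Nat.card_zpowers f).trans hf) hg
  ext x
  refine ⟨fun hx => ?_, smul_eq_self_of_mem_zpowers (y := f) g.2⟩
  exact smul_eq_self_of_mem_zpowers
    (htop ▸ Subgroup.mem_top (⟨f, Subgroup.mem_zpowers f⟩ : Subgroup.zpowers f)) hx

theorem prime_mul_orbitCount [Finite D] {p : ℕ} [Fact p.Prime] {f : Perm D} (hf : orderOf f = p) :
    p * orbitCount f = Nat.card D + (p - 1) * Nat.card (Function.fixedPoints f) := by
  classical
  have := Fintype.ofFinite D
  have := Fintype.ofFinite (Quotient (MulAction.orbitRel (Subgroup.zpowers f) D))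
  have := Fintype.ofFinite (Subgroup.zpowers f)
  have burnside := MulAction.sum_card_fixedBy_eq_card_orbits_mul_card_group (Subgroup.zpowers f) D
  simp only [← Nat.card_eq_fintype_card, card_orbits_zpowers, Nat.card_zpowers, hf] at burnside
  have hfixed : ∑ g ∈ ({1}ᶜ : Finset (Subgroup.zpowers f)), Nat.card (MulAction.fixedBy D g) =
      (p - 1) * Nat.card (Function.fixedPoints f) := by
    rw [Finset.sum_congr rfl fun g hg => by rw [fixedBy_zpowers hf (by simpa using hg)],
      Finset.sum_const, Finset.card_compl, Finset.card_singleton, ← Nat.card_eq_fintype_card,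
      Nat.card_zpowers, hf, smul_eq_mul]
  rw [mul_comm, ← burnside, Fintype.sum_eq_add_sum_compl 1, hfixed,
    MulAction.fixedBy_one_eq_univ, Nat.card_coe_set_eq, Set.ncard_univ]

end Perm

variable {n : ℕ} {D E : Type} {α : Type u}

/-- The data of a triangulation, with its conditions in the form in which they are easy to check:
connectedness and the vertices are described by universal properties, and Euler's formula is left
out, since it amounts to a condition on the number of darts. -/
structure Gluing (n : ℕ) (D : Type) where
  next : D → D
  opp : D → D
  root : D
  vert : D → Option (Fin n)
  opp_opp : ∀ d, opp (opp d) = d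
  opp_ne : ∀ d, opp d ≠ d
  next_root : next root = root
  next_ne : ∀ d, d ≠ root → next d ≠ d
  next_next_next : ∀ d, next (next (next d)) = d
  mem_of_closed : ∀ C : Set D, root ∈ C → (∀ d ∈ C, next d ∈ C) → (∀ d ∈ C, opp d ∈ C) →
    ∀ d, d ∈ C
  vert_next_opp : ∀ d, vert (next (opp d)) = vert d
  rel_of_vert_eq : ∀ r : Setoid D, (∀ d, r d (next (opp d))) → ∀ d d', vert d = vert d' → r d d'
  vert_surjective : Function.Surjective vert
  vert_root : vert root = none

namespace Gluing

/-- The permutation underlying `next`. -/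
def nextPerm (T : Gluing n D) : Perm D :=
  ⟨T.next, fun d => T.next (T.next d), T.next_next_next, T.next_next_next⟩

/-- The permutation underlying `opp`. -/
def oppPerm (T : Gluing n D) : Perm D :=
  ⟨T.opp, T.opp, T.opp_opp, T.opp_opp⟩

theorem vert_eq_iff (T : Gluing n D) (d d' : D) :
    T.vert d = T.vert d' ↔ (T.nextPerm * T.oppPerm).SameCycle d d' :=
  ⟨T.rel_of_vert_eq (Perm.SameCycle.setoid _) (fun _ => ⟨1, rfl⟩) d d',
    rel_of_sameCycle (Setoid.ker T.vert).iseqv fun d => (T.vert_next_opp d).symm⟩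

theorem exists_mem_closure (T : Gluing n D) (d d' : D) :
    ∃ g ∈ Subgroup.closure ({T.nextPerm, T.oppPerm} : Set (Perm D)), g d = d' := by
  have hroot : ∀ d, ∃ g ∈ Subgroup.closure ({T.nextPerm, T.oppPerm} : Set (Perm D)),
      g T.root = d := by
    refine T.mem_of_closed {d | ∃ g ∈ Subgroup.closure ({T.nextPerm, T.oppPerm} : Set (Perm D)),
      g T.root = d} ⟨1, one_mem _, rfl⟩ ?_ ?_
    · rintro _ ⟨g, hg, rfl⟩
      exact ⟨T.nextPerm * g, mul_mem (Subgroup.subset_closure (by simp)) hg, rfl⟩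
    · rintro _ ⟨g, hg, rfl⟩
      exact ⟨T.oppPerm * g, mul_mem (Subgroup.subset_closure (by simp)) hg, rfl⟩
  obtain ⟨g, hg, rfl⟩ := hroot d
  obtain ⟨g', hg', rfl⟩ := hroot d'
  exact ⟨g' * g⁻¹, mul_mem hg' (inv_mem hg), by simp⟩

end Gluing

namespace Triangulation

theorem vert_next_opp (T : Triangulation n D) (d : D) : T.vert (T.next (T.opp d)) = T.vert d :=
  ((T.vert_eq_iff d _).2 ⟨1, rfl⟩).symm

theorem vert_next (T : Triangulation n D) (d : D) : T.vert (T.next d) = T.vert (T.opp d) := by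
  rw [← T.vert_next_opp (T.opp d), T.opp_opp]

theorem rel_of_vert_eq (T : Triangulation n D) (r : Setoid D) (h : ∀ d, r d (T.next (T.opp d)))
    {d d' : D} (hd : T.vert d = T.vert d') : r d d' :=
  rel_of_sameCycle r.iseqv h ((T.vert_eq_iff d d').1 hd)

end Triangulation

theorem two_mul_orbitCount_opp [Finite D] {opp : Perm D} (opp_opp : ∀ d, opp (opp d) = d)
    (opp_ne : ∀ d, opp d ≠ d) [Nonempty D] : 2 * orbitCount opp = Nat.card D := by
  obtain ⟨d⟩ := ‹Nonempty D›
  have horder : orderOf opp = 2 := orderOf_eq_prime (Equiv.ext opp_opp) fun h =>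
    opp_ne d (by rw [h, Perm.one_apply])
  have hfixed : Function.fixedPoints opp = ∅ := Set.eq_empty_of_forall_notMem opp_ne
  simpa [hfixed] using prime_mul_orbitCount horder

theorem three_mul_orbitCount_next [Finite D] {next : Perm D} {root d : D}
    (next_next_next : ∀ d, next (next (next d)) = d) (next_root : next root = root)
    (next_ne : ∀ d, d ≠ root → next d ≠ d) (hd : d ≠ root) :
    3 * orbitCount next = Nat.card D + 2 := by
  have horder : orderOf next = 3 := orderOf_eq_prime (Equiv.ext next_next_next) fun h =>
    next_ne d hd (by rw [h, Perm.one_apply])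
  have hfixed : Function.fixedPoints next = {root} :=
    Set.ext fun d => ⟨fun h => by_contra fun hd => next_ne d hd h, fun h => h ▸ next_root⟩
  simpa [hfixed] using prime_mul_orbitCount horder

theorem Triangulation.card_darts [Finite D] (T : Triangulation n D) : Nat.card D + 2 = 6 * n := by
  have : Nonempty D := ⟨T.root⟩
  have hopp := two_mul_orbitCount_opp T.opp_opp T.opp_ne
  have hnext := three_mul_orbitCount_next T.next_next_next T.next_root T.next_ne (T.opp_ne T.root)
  have hvert : orbitCount (T.next * T.opp) = n + 1 := by
    simpa using orbitCount_eq_of_labels T.vert_eq_iff T.vert_surjective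
  have := T.euler
  omega

namespace Gluing

/-- A gluing with the number of darts that Euler's formula demands is a triangulation. -/
def toTriangulation [Finite D] (T : Gluing n D) (h : Nat.card D + 2 = 6 * n) :
    Triangulation n D where
  next := T.nextPerm
  opp := T.oppPerm
  root := T.root
  vert := T.vert
  opp_opp := T.opp_opp
  opp_ne := T.opp_ne
  next_root := T.next_root
  next_ne := T.next_ne
  next_next_next := T.next_next_next
  connected := T.exists_mem_closure
  vert_eq_iff := T.vert_eq_iff
  vert_surjective := T.vert_surjective
  vert_root := T.vert_root
  euler := by
    have : Nonempty D := ⟨T.root⟩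
    have hopp := two_mul_orbitCount_opp (opp := T.oppPerm) T.opp_opp T.opp_ne
    have hnext := three_mul_orbitCount_next (next := T.nextPerm) T.next_next_next T.next_root
      T.next_ne (T.opp_ne T.root)
    have hvert : orbitCount (T.nextPerm * T.oppPerm) = n + 1 := by
      simpa using orbitCount_eq_of_labels T.vert_eq_iff T.vert_surjective
    omega

/-- The gluing with its darts renamed along a bijection. -/
def transport (T : Gluing n D) (e : D ≃ E) : Gluing n E where
  next d := e (T.next (e.symm d))
  opp d := e (T.opp (e.symm d))
  root := e T.root
  vert d := T.vert (e.symm d)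
  opp_opp d := by simp [T.opp_opp]
  opp_ne d := by simp [← Equiv.eq_symm_apply, T.opp_ne]
  next_root := by simp [T.next_root]
  next_ne d hd := by
    rw [Ne, ← Equiv.eq_symm_apply]
    exact T.next_ne _ (by rwa [Ne, Equiv.symm_apply_eq])
  next_next_next d := by simp [T.next_next_next]
  mem_of_closed C hroot hnext hopp d := by
    simpa using T.mem_of_closed (e ⁻¹' C) hroot (fun d hd => by simpa using hnext _ hd)
      (fun d hd => by simpa using hopp _ hd) (e.symm d)
  vert_next_opp d := by simp [T.vert_next_opp]
  rel_of_vert_eq r h d d' hd := by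
    have hr := T.rel_of_vert_eq (r.comap e) (fun d => by
      rw [Setoid.comap_rel]
      simpa using h (e d)) _ _ hd
    simpa [Setoid.comap_rel] using hr
  vert_surjective := T.vert_surjective.comp e.symm.surjective
  vert_root := by simp [T.vert_root]

/-- The disk with one interior marked point, cut into a self-folded triangle. -/
def one : Gluing 1 (Fin 4) where
  next := ![0, 2, 3, 1]
  opp := ![1, 0, 3, 2]
  root := 0
  vert := ![none, none, none, some 0]
  opp_opp := by decide
  opp_ne := by decide
  next_root := by decide
  next_ne := by decide
  next_next_next := by decide
  mem_of_closed C hroot hnext hopp := by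
    have h1 : 1 ∈ C := hopp 0 hroot
    have h2 : 2 ∈ C := hnext 1 h1
    have h3 : 3 ∈ C := hnext 2 h2
    intro d
    fin_cases d <;> assumption
  vert_next_opp := by decide
  rel_of_vert_eq r h d d' hd := by
    have hzero : ∀ d : Fin 4, d ≠ 3 → r d 0
      | 0, _ => r.refl 0
      | 1, _ => h 1
      | 2, _ => r.trans (h 2) (h 1)
      | 3, h3 => absurd rfl h3
    by_cases h3 : d = 3
    · obtain rfl : d = d' := by revert d d'; decide
      exact r.refl d
    · have h3' : d' ≠ 3 := by revert d d'; decide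
      exact r.trans (hzero d h3) (r.symm (hzero d' h3'))
  vert_surjective := by decide
  vert_root := by decide

section Insert

variable (T : Gluing n D)

open Classical in
/-- The faces of the gluing that encloses the boundary curve of `T` and a loop around a new marked
point by a new boundary curve. The new darts are the sides `inr 0`, `inr 1` of the new boundary
curve, the sides `inr 2`, `inr 3` of the new loop, and the sides `inr 4`, `inr 5` of the edge inside
this loop. -/
noncomputable def insertNext : D ⊕ Fin 6 → D ⊕ Fin 6 :=
  Sum.elim (fun d => if d = T.root then .inr 2 else .inl (T.next d))
    ![.inr 0, .inl T.root, .inr 1, .inr 4, .inr 5, .inr 3]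

/-- The edges of the gluing described at `insertNext`. -/
def insertOpp : D ⊕ Fin 6 → D ⊕ Fin 6 :=
  Sum.map T.opp ![1, 0, 3, 2, 5, 4]

/-- The vertices of the gluing described at `insertNext`. -/
def insertVert : D ⊕ Fin 6 → Option (Fin (n + 1)) :=
  Sum.elim (fun d => (T.vert d).map Fin.castSucc) ![none, none, none, none, none, some (Fin.last n)]

theorem next_eq_root_iff {d : D} : T.next d = T.root ↔ d = T.root := by
  refine ⟨fun h => ?_, fun h => h ▸ T.next_root⟩
  rw [← T.next_next_next d, h, T.next_root, T.next_root]

theorem insertNext_insertNext_insertNext (d : D ⊕ Fin 6) :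
    T.insertNext (T.insertNext (T.insertNext d)) = d := by
  rcases d with d | d
  · by_cases h : d = T.root <;>
      simp [insertNext, h, T.next_eq_root_iff, T.next_next_next]
  · fin_cases d <;> simp [insertNext]

theorem insertVert_insertNext_insertOpp (d : D ⊕ Fin 6) :
    T.insertVert (T.insertNext (T.insertOpp d)) = T.insertVert d := by
  rcases d with d | d
  · by_cases h : T.opp d = T.root
    · have hd := T.vert_next_opp d
      rw [h, T.next_root, T.vert_root] at hd
      simp [insertNext, insertOpp, insertVert, h, ← hd]
    · simp [insertNext, insertOpp, insertVert, h, T.vert_next_opp]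
  · fin_cases d <;> simp [insertNext, insertOpp, insertVert, T.vert_root]

theorem insert_mem_of_closed (C : Set (D ⊕ Fin 6)) (hroot : .inr 0 ∈ C)
    (hnext : ∀ d ∈ C, T.insertNext d ∈ C) (hopp : ∀ d ∈ C, T.insertOpp d ∈ C) (d : D ⊕ Fin 6) :
    d ∈ C := by
  have h1 : .inr 1 ∈ C := hopp _ hroot
  have hinl : .inl T.root ∈ C := hnext _ h1
  have h2 : .inr 2 ∈ C := by simpa [insertNext] using hnext _ hinl
  have h3 : .inr 3 ∈ C := hopp _ h2
  have h4 : .inr 4 ∈ C := hnext _ h3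
  have h5 : .inr 5 ∈ C := hnext _ h4
  have hT := T.mem_of_closed (Sum.inl ⁻¹' C) hinl (fun d hd => by
    by_cases h : d = T.root
    · rwa [h, T.next_root]
    · simpa [insertNext, h] using hnext _ hd) (fun d hd => hopp _ hd)
  rcases d with d | d
  · exact hT d
  · fin_cases d <;> assumption

theorem insert_rel_of_vert_eq (r : Setoid (D ⊕ Fin 6))
    (h : ∀ d, r d (T.insertNext (T.insertOpp d))) (d d' : D ⊕ Fin 6)
    (hd : T.insertVert d = T.insertVert d') : r d d' := by
  have hinr : ∀ i : Fin 6, i ≠ 5 → r (.inr i) (.inl T.root) := by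
    have h0 : r (.inr 0) (.inl T.root) := h (.inr 0)
    have h1 : r (.inr 1) (.inl T.root) := r.trans (h (.inr 1)) h0
    have h3 : r (.inr 3) (.inl T.root) := r.trans (h (.inr 3)) h1
    have h4 : r (.inr 4) (.inl T.root) := r.trans (h (.inr 4)) h3
    have h2 : r (.inr 2) (.inl T.root) := r.trans (h (.inr 2)) h4
    intro i hi
    fin_cases i <;> first | assumption | exact absurd rfl hi
  have hinl := T.rel_of_vert_eq (r.comap .inl) fun d => by
    rw [Setoid.comap_rel]
    by_cases hd : T.opp d = T.root
    · rw [hd, T.next_root]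
      exact r.trans (by simpa [insertNext, insertOpp, hd] using h (.inl d)) (hinr 2 (by decide))
    · simpa [insertNext, insertOpp, hd] using h (.inl d)
  have hold : ∀ x, x = .inr 5 ∨ ∃ d, r x (.inl d) ∧ T.insertVert x = (T.vert d).map Fin.castSucc
    | .inl d => .inr ⟨d, r.refl _, rfl⟩
    | .inr i => or_iff_not_imp_left.2 fun hi => ⟨T.root, hinr i fun h => hi (h ▸ rfl), by
        fin_cases i <;> simp_all [insertVert, T.vert_root]⟩
  have hnew (o : Option (Fin n)) : o.map Fin.castSucc ≠ T.insertVert (.inr 5) := by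
    cases o <;> simp [insertVert, Fin.castSucc_ne_last]
  rcases hold d with rfl | ⟨e, hde, hve⟩ <;> rcases hold d' with rfl | ⟨e', hde', hve'⟩
  · exact r.refl _
  · exact absurd (hd.trans hve').symm (hnew _)
  · exact absurd (hve.symm.trans hd) (hnew _)
  · refine r.trans hde (r.trans (hinl e e' ?_) (r.symm hde'))
    exact Option.map_injective (Fin.castSucc_injective n) (hve.symm.trans (hd.trans hve'))

/-- The gluing described at `insertNext`. -/
noncomputable def insert : Gluing (n + 1) (D ⊕ Fin 6) where
  next := T.insertNext
  opp := T.insertOpp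
  root := .inr 0
  vert := T.insertVert
  opp_opp d := by
    rcases d with d | d
    · simp [insertOpp, T.opp_opp]
    · fin_cases d <;> rfl
  opp_ne d := by
    rcases d with d | d
    · simp [insertOpp, T.opp_ne]
    · fin_cases d <;> simp [insertOpp]
  next_root := rfl
  next_ne d hd := by
    rcases d with d | d
    · by_cases h : d = T.root
      · simp [insertNext, h]
      · simpa [insertNext, h] using T.next_ne d h
    · fin_cases d <;> simp [insertNext] at hd ⊢
  next_next_next := T.insertNext_insertNext_insertNext
  mem_of_closed := T.insert_mem_of_closed
  vert_next_opp := T.insertVert_insertNext_insertOpp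
  rel_of_vert_eq := T.insert_rel_of_vert_eq
  vert_surjective w := by
    rcases w with _ | w
    · exact ⟨.inr 0, rfl⟩
    · induction w using Fin.lastCases with
      | last => exact ⟨.inr 5, rfl⟩
      | cast w =>
        obtain ⟨d, hd⟩ := T.vert_surjective (some w)
        exact ⟨.inl d, by simp [insertVert, hd]⟩
  vert_root := rfl

end Insert

end Gluing

theorem exists_gluing (n : ℕ) (hn : 1 ≤ n) :
    ∃ D : Type, Finite D ∧ Nat.card D + 2 = 6 * n ∧ Nonempty (Gluing n D) := by
  induction n, hn using Nat.le_induction with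
  | base => exact ⟨Fin 4, inferInstance, by simp, ⟨Gluing.one⟩⟩
  | succ n _ ih =>
    obtain ⟨D, _, hcard, ⟨T⟩⟩ := ih
    refine ⟨D ⊕ Fin 6, inferInstance, ?_, ⟨T.insert⟩⟩
    rw [Nat.card_sum, Nat.card_eq_fintype_card (α := Fin 6), Fintype.card_fin]
    omega

theorem nonempty_tri (n : ℕ) (hn : 1 ≤ n) : Nonempty (Tri n) := by
  obtain ⟨D, _, hcard, ⟨T⟩⟩ := exists_gluing n hn
  exact ⟨_, (T.transport (Finite.equivFin D)).toTriangulation (by simpa using hcard)⟩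

/-! ### Simultaneous flips -/

namespace Triangulation

theorem mem_of_closed (T : Triangulation n D) {C : Set D} (hroot : T.root ∈ C)
    (hnext : ∀ d ∈ C, T.next d ∈ C) (hopp : ∀ d ∈ C, T.opp d ∈ C) (d : D) : d ∈ C := by
  obtain ⟨g, hg, rfl⟩ := T.connected T.root d
  suffices h : ∀ x, g x ∈ C ↔ x ∈ C from (h T.root).2 hroot
  induction hg using Subgroup.closure_induction with
  | mem g hg =>
    rcases hg with rfl | rfl
    · exact fun x => ⟨fun hx => T.next_next_next x ▸ hnext _ (hnext _ hx), hnext x⟩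
    · exact fun x => ⟨fun hx => T.opp_opp x ▸ hopp _ hx, hopp x⟩
  | one => exact fun _ => Iff.rfl
  | mul g g' _ _ hg hg' => exact fun x => (hg _).trans (hg' x)
  | inv g _ hg => exact fun x => by simpa using (hg (g⁻¹ x)).symm

/-- The set `S` of darts belongs to arcs that can be flipped simultaneously. -/
structure Flippable (T : Triangulation n D) (S : Set D) : Prop where
  root : T.root ∉ S
  opp : ∀ d ∈ S, T.opp d ∈ S
  next : ∀ d ∈ S, T.next d ∉ S
  next_next : ∀ d ∈ S, T.next (T.next d) ∉ S

open Classical in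
/-- The successor of a dart after the simultaneous flip along `S`. -/
noncomputable def flipNext (T : Triangulation n D) (S : Set D) (d : D) : D :=
  if d ∈ S then T.next (T.next (T.opp d))
  else if T.next d ∈ S then T.next (T.opp (T.next d))
  else if T.next (T.next d) ∈ S then T.next (T.next d)
  else T.next d

open Classical in
/-- The initial point of a dart after the simultaneous flip along `S`. -/
noncomputable def flipVert (T : Triangulation n D) (S : Set D) (d : D) : Option (Fin n) :=
  if d ∈ S then T.vert (T.next (T.next d)) else T.vert d

open Classical in
/-- A dart outside `S` with the same initial point as `d`. -/
noncomputable def unflipped (T : Triangulation n D) (S : Set D) (d : D) : D :=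
  if d ∈ S then T.next (T.opp d) else d

section Flip

variable {T : Triangulation n D} {S : Set D} {d : D}

theorem flipNext_mem (hd : d ∈ S) : T.flipNext S d = T.next (T.next (T.opp d)) :=
  if_pos hd

theorem flipNext_notMem (h1 : d ∉ S) (h2 : T.next d ∉ S) (h3 : T.next (T.next d) ∉ S) :
    T.flipNext S d = T.next d := by
  rw [flipNext, if_neg h1, if_neg h2, if_neg h3]

theorem flipVert_mem (hd : d ∈ S) : T.flipVert S d = T.vert (T.next (T.next d)) :=
  if_pos hd

theorem flipVert_notMem (hd : d ∉ S) : T.flipVert S d = T.vert d :=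
  if_neg hd

theorem unflipped_mem (hd : d ∈ S) : T.unflipped S d = T.next (T.opp d) :=
  if_pos hd

theorem unflipped_notMem (hd : d ∉ S) : T.unflipped S d = d :=
  if_neg hd

theorem vert_unflipped (d : D) : T.vert (T.unflipped S d) = T.vert d := by
  by_cases hd : d ∈ S
  · rw [unflipped_mem hd, T.vert_next_opp]
  · rw [unflipped_notMem hd]

namespace Flippable

theorem opp_notMem (h : T.Flippable S) (hd : d ∉ S) : T.opp d ∉ S :=
  fun hs => hd (T.opp_opp d ▸ h.opp _ hs)

theorem flipNext_next_mem (h : T.Flippable S) (hd : T.next d ∈ S) :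
    T.flipNext S d = T.next (T.opp (T.next d)) := by
  rw [flipNext, if_neg fun hs => h.next d hs hd, if_pos hd]

theorem flipNext_next_next_mem (h : T.Flippable S) (hd : T.next (T.next d) ∈ S) :
    T.flipNext S d = T.next (T.next d) := by
  rw [flipNext, if_neg fun hs => h.next_next d hs hd, if_neg fun hs => h.next _ hs hd, if_pos hd]

theorem flipNext_next (h : T.Flippable S) (hd : d ∈ S) : T.flipNext S (T.next d) = d := by
  rw [h.flipNext_next_next_mem (by rwa [T.next_next_next]), T.next_next_next]

theorem flipNext_next_next (h : T.Flippable S) (hd : d ∈ S) :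
    T.flipNext S (T.next (T.next d)) = T.next (T.opp d) := by
  rw [h.flipNext_next_mem (by rwa [T.next_next_next]), T.next_next_next]

theorem flipNext_flipNext_flipNext (h : T.Flippable S) (d : D) :
    T.flipNext S (T.flipNext S (T.flipNext S d)) = d := by
  by_cases h1 : d ∈ S
  · rw [flipNext_mem h1, h.flipNext_next_next (h.opp d h1), T.opp_opp, h.flipNext_next h1]
  by_cases h2 : T.next d ∈ S
  · have ho := h.opp _ h2
    rw [h.flipNext_next_mem h2, h.flipNext_next ho, flipNext_mem ho, T.opp_opp, T.next_next_next]
  by_cases h3 : T.next (T.next d) ∈ S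
  · rw [h.flipNext_next_next_mem h3, flipNext_mem h3, h.flipNext_next_next (h.opp _ h3),
      T.opp_opp, T.next_next_next]
  · rw [flipNext_notMem h1 h2 h3, flipNext_notMem h2 h3 (by rwa [T.next_next_next]),
      flipNext_notMem h3 (by rwa [T.next_next_next]) (by rwa [T.next_next_next]), T.next_next_next]

theorem flipNext_root (h : T.Flippable S) : T.flipNext S T.root = T.root := by
  rw [flipNext_notMem] <;> simp only [T.next_root, h.root, not_false_eq_true]

theorem flipNext_ne (h : T.Flippable S) (hd : d ≠ T.root) : T.flipNext S d ≠ d := by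
  by_cases h1 : d ∈ S
  · rw [flipNext_mem h1]
    exact fun e => h.next_next _ (h.opp d h1) (by rwa [e])
  by_cases h2 : T.next d ∈ S
  · rw [h.flipNext_next_mem h2]
    exact fun e => h.next_next _ (h.opp _ h2) (by rwa [e])
  by_cases h3 : T.next (T.next d) ∈ S
  · rw [h.flipNext_next_next_mem h3]
    exact fun e => h1 (e ▸ h3)
  · rw [flipNext_notMem h1 h2 h3]
    exact T.next_ne d hd

theorem flipVert_flipNext_opp (h : T.Flippable S) (d : D) :
    T.flipVert S (T.flipNext S (T.opp d)) = T.flipVert S d := by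
  by_cases hd : d ∈ S
  · rw [flipVert_mem hd, flipNext_mem (h.opp _ hd), T.opp_opp, flipVert_notMem (h.next_next _ hd)]
  rw [flipVert_notMem hd]
  by_cases h1 : T.next (T.opp d) ∈ S
  · rw [h.flipNext_next_mem h1, flipVert_notMem (h.next _ (h.opp _ h1)), T.vert_next_opp,
      T.vert_next_opp]
  by_cases h2 : T.next (T.next (T.opp d)) ∈ S
  · rw [h.flipNext_next_next_mem h2, flipVert_mem h2, T.next_next_next, T.vert_next_opp]
  · rw [flipNext_notMem (h.opp_notMem hd) h1 h2, flipVert_notMem h1, T.vert_next_opp]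

theorem mem_of_closed (h : T.Flippable S) {C : Set D} (hroot : T.root ∈ C)
    (hnext : ∀ d ∈ C, T.flipNext S d ∈ C) (hopp : ∀ d ∈ C, T.opp d ∈ C) (d : D) : d ∈ C := by
  refine T.mem_of_closed hroot (fun d hd => ?_) hopp d
  have of_flipNext {x : D} (hx : T.flipNext S x ∈ C) : x ∈ C :=
    h.flipNext_flipNext_flipNext x ▸ hnext _ (hnext _ hx)
  by_cases h1 : d ∈ S
  · exact of_flipNext (by rwa [h.flipNext_next h1])
  by_cases h2 : T.next d ∈ S
  · suffices T.opp (T.next d) ∈ C from T.opp_opp (T.next d) ▸ hopp _ this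
    exact of_flipNext (by rwa [flipNext_mem (h.opp _ h2), T.opp_opp, T.next_next_next])
  by_cases h3 : T.next (T.next d) ∈ S
  · have := hnext _ (hopp _ (hnext d hd))
    rwa [h.flipNext_next_next_mem h3, flipNext_mem (h.opp _ h3), T.opp_opp,
      T.next_next_next] at this
  · exact flipNext_notMem h1 h2 h3 ▸ hnext d hd

theorem rel_next_next (h : T.Flippable S) (r : Setoid D)
    (hr : ∀ d, r d (T.flipNext S (T.opp d))) (hd : d ∈ S) : r d (T.next (T.next d)) := by
  have := hr d
  rwa [flipNext_mem (h.opp d hd), T.opp_opp] at this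

theorem rel_unflipped_next_opp (h : T.Flippable S) (r : Setoid D)
    (hr : ∀ d, r d (T.flipNext S (T.opp d))) (d : D) :
    r (T.unflipped S d) (T.unflipped S (T.next (T.opp d))) := by
  by_cases hd : d ∈ S
  · rw [unflipped_mem hd, unflipped_notMem (h.next _ (h.opp d hd))]
  rw [unflipped_notMem hd]
  by_cases h1 : T.next (T.opp d) ∈ S
  · rw [unflipped_mem h1, ← h.flipNext_next_mem h1]
    exact hr d
  rw [unflipped_notMem h1]
  by_cases h2 : T.next (T.next (T.opp d)) ∈ S
  · have hback := h.rel_next_next r hr h2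
    rw [T.next_next_next] at hback
    exact r.trans (h.flipNext_next_next_mem h2 ▸ hr d) hback
  · exact flipNext_notMem (h.opp_notMem hd) h1 h2 ▸ hr d

theorem rel_of_flipVert_eq (h : T.Flippable S) (r : Setoid D)
    (hr : ∀ d, r d (T.flipNext S (T.opp d))) (d d' : D)
    (hd : T.flipVert S d = T.flipVert S d') : r d d' := by
  have exists_notMem (d : D) : ∃ x, x ∉ S ∧ r d x ∧ T.vert x = T.flipVert S d := by
    by_cases hd : d ∈ S
    · exact ⟨_, h.next_next d hd, h.rel_next_next r hr hd, (flipVert_mem hd).symm⟩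
    · exact ⟨d, hd, r.refl d, (flipVert_notMem hd).symm⟩
  obtain ⟨x, hx, hdx, hv⟩ := exists_notMem d
  obtain ⟨x', hx', hdx', hv'⟩ := exists_notMem d'
  have hxx' := T.rel_of_vert_eq (r.comap (T.unflipped S)) (h.rel_unflipped_next_opp r hr)
    (hv.trans (hd.trans hv'.symm))
  rw [Setoid.comap_rel, unflipped_notMem hx, unflipped_notMem hx'] at hxx'
  exact r.trans hdx (r.trans hxx' (r.symm hdx'))

/-- The gluing that arises by the simultaneous flip along `S`. -/
noncomputable def gluing (h : T.Flippable S) : Gluing n D where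
  next := T.flipNext S
  opp := T.opp
  root := T.root
  vert := T.flipVert S
  opp_opp := T.opp_opp
  opp_ne := T.opp_ne
  next_root := h.flipNext_root
  next_ne _ := h.flipNext_ne
  next_next_next := h.flipNext_flipNext_flipNext
  mem_of_closed _ := h.mem_of_closed
  vert_next_opp := h.flipVert_flipNext_opp
  rel_of_vert_eq := h.rel_of_flipVert_eq
  vert_surjective w := by
    obtain ⟨d, rfl⟩ := T.vert_surjective w
    have hd : T.unflipped S d ∉ S := by
      by_cases hd : d ∈ S
      · exact unflipped_mem hd ▸ h.next _ (h.opp d hd)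
      · rwa [unflipped_notMem hd]
    exact ⟨T.unflipped S d, (flipVert_notMem hd).trans (vert_unflipped d)⟩
  vert_root := (flipVert_notMem h.root).trans T.vert_root

theorem exists_flipAlong [Finite D] (h : T.Flippable S) : ∃ T', FlipAlong S T T' :=
  ⟨h.gluing.toTriangulation T.card_darts, h.root,
    fun d hd => ⟨h.opp d hd, h.next d hd, h.next_next d hd⟩, Equiv.ext fun _ => rfl,
    fun _ hd => ⟨h.flipNext_next hd, flipNext_mem hd, h.flipNext_next_next hd⟩,
    fun _ => flipNext_notMem, fun _ => flipVert_mem, fun _ => flipVert_notMem⟩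

end Flippable

end Flip

end Triangulation

/-! ### Developments -/

/-- The sides of the triangle to the left of `d`. -/
def tri (next : D → D) (d : D) : Multiset D :=
  {d} + {next d} + {next (next d)}

/-- The darts met when the triangles behind the dart `d` are developed in the plane according to the
shape of a tree: a product stands for a triangle that is entered through its side `opp d` and left
through its other two sides. -/
def darts (next opp : D → D) (d : D) : FreeMagma α → Multiset D
  | .of _ => {d}
  | l * r => {d} + {opp d} + darts next opp (next (opp d)) l +
      darts next opp (next (next (opp d))) r

/-- The darts at the leaves of a development, from left to right. -/
def leafDarts (next opp : D → D) (d : D) : FreeMagma α → List D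
  | .of _ => [d]
  | l * r => leafDarts next opp (next (opp d)) l ++ leafDarts next opp (next (next (opp d))) r

section Map

variable {next opp : D → D} {next' opp' : E → E} {f : D → E}

theorem map_darts (hnext : ∀ d, f (next d) = next' (f d)) (hopp : ∀ d, f (opp d) = opp' (f d))
    (d : D) (t : FreeMagma α) : (darts next opp d t).map f = darts next' opp' (f d) t := by
  induction t generalizing d with
  | ih1 a => rfl
  | ih2 l r hl hr => simp only [darts, Multiset.map_add, Multiset.map_singleton, hl, hr,
      hnext, hopp]

theorem map_leafDarts (hnext : ∀ d, f (next d) = next' (f d)) (hopp : ∀ d, f (opp d) = opp' (f d))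
    (d : D) (t : FreeMagma α) : (leafDarts next opp d t).map f = leafDarts next' opp' (f d) t := by
  induction t generalizing d with
  | ih1 a => rfl
  | ih2 l r hl hr => simp only [leafDarts, List.map_append, hl, hr, hnext, hopp]

end Map

section Darts

variable {next opp : D → D}

theorem length_leafDarts (d : D) (t : FreeMagma α) :
    (leafDarts next opp d t).length = t.length := by
  induction t generalizing d with
  | ih1 a => rfl
  | ih2 l r hl hr => simp only [leafDarts, List.length_append, FreeMagma.length, hl, hr]

theorem card_darts (d : D) (t : FreeMagma α) : (darts next opp d t).card + 2 = 3 * t.length := by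
  induction t generalizing d with
  | ih1 a => rfl
  | ih2 l r hl hr =>
    have := hl (next (opp d))
    have := hr (next (next (opp d)))
    simp only [darts, Multiset.card_add, Multiset.card_singleton, FreeMagma.length]
    omega

theorem mem_darts_self (d : D) (t : FreeMagma α) : d ∈ darts next opp d t := by
  cases t <;> simp [darts]

theorem opp_mem_darts_or_mem_leafDarts (opp_opp : ∀ d, opp (opp d) = d) {d x : D} {t : FreeMagma α}
    (hx : x ∈ darts next opp d t) : opp x ∈ darts next opp d t ∨ x ∈ leafDarts next opp d t := by
  induction t generalizing d with
  | ih1 a => exact .inr (by simpa [darts, leafDarts] using hx)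
  | ih2 l r hl hr =>
    simp only [darts, leafDarts, Multiset.mem_add, Multiset.mem_singleton,
      List.mem_append] at hx ⊢
    rcases hx with ((rfl | rfl) | hx) | hx
    · exact .inl (.inl (.inl (.inr rfl)))
    · exact .inl (.inl (.inl (.inl (opp_opp d))))
    · exact (hl hx).imp (fun h => .inl (.inr h)) .inl
    · exact (hr hx).imp .inr .inr

theorem forall_mem_darts {C : D → Prop} (hopp : ∀ x, C (opp x) → C x)
    (hnext : ∀ x, C (next x) → C (next (next x)) → C x) {d : D} {t : FreeMagma α}
    (hleaf : ∀ x ∈ leafDarts next opp d t, C x) :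
    ∀ x ∈ darts next opp d t, C x := by
  induction t generalizing d with
  | ih1 a => simpa [darts, leafDarts] using hleaf
  | ih2 l r hl hr =>
    simp only [leafDarts, List.mem_append, or_imp, forall_and] at hleaf
    have hleft := hl hleaf.1
    have hright := hr hleaf.2
    have hd : C (opp d) := hnext _ (hleft _ (mem_darts_self _ _)) (hright _ (mem_darts_self _ _))
    simp only [darts, Multiset.mem_add, Multiset.mem_singleton]
    rintro x (((rfl | rfl) | hx) | hx)
    exacts [hopp x hd, hd, hleft x hx, hright x hx]

end Darts

/-! ### Realizing rotations by flips -/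

/-- Rotating the development behind `d` of shape `t` into the shape `t'` amounts to flipping the
darts in `Q`: the triangles met are those of the darts in `U + Q`, and a map `next'` that agrees
with `next` on the triangles of `U` and is flipped at the darts in `Q` has the same development,
with shape `t'`. -/
structure Realizes (next opp : D → D) (d : D) (t t' : FreeMagma α) (U Q : Multiset D) : Prop where
  darts_eq : darts next opp d t = {d} + (U + Q).bind (tri next)
  opp_mem : ∀ x ∈ Q, opp x ∈ Q
  leafDarts_le : (leafDarts next opp d t : Multiset D) + Q ≤ darts next opp d t
  eq_of_flip : ∀ next' : D → D,
    (∀ x ∈ U, next' x = next x ∧ next' (next x) = next (next x)) →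
    (∀ x ∈ Q, next' (next x) = x ∧ next' x = next (next (opp x)) ∧
      next' (next (next x)) = next (opp x)) →
    darts next' opp d t' = darts next opp d t ∧ leafDarts next' opp d t' = leafDarts next opp d t

namespace Realizes

variable {next opp : D → D} {d : D} {a a' b b' c c' : FreeMagma α} {U U' U'' Q Q' Q'' : Multiset D}

theorem of (d : D) (i : α) : Realizes next opp d (of i) (of i) 0 0 :=
  ⟨by simp [darts], by simp, by simp [darts, leafDarts], by simp [darts, leafDarts]⟩

theorem mul (ha : Realizes next opp (next (opp d)) a a' U Q)
    (hb : Realizes next opp (next (next (opp d))) b b' U' Q') :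
    Realizes next opp d (a * b) (a' * b') ({opp d} + (U + U')) (Q + Q') where
  darts_eq := by
    simp only [darts, ha.darts_eq, hb.darts_eq, Multiset.add_bind, Multiset.singleton_bind, tri]
    abel
  opp_mem x hx := by
    simp only [Multiset.mem_add] at hx ⊢
    exact hx.imp (ha.opp_mem x) (hb.opp_mem x)
  leafDarts_le := by
    calc (leafDarts next opp d (a * b) : Multiset D) + (Q + Q')
        = ((leafDarts next opp (next (opp d)) a : Multiset D) + Q) +
            ((leafDarts next opp (next (next (opp d))) b : Multiset D) + Q') := by
          simp only [leafDarts, ← Multiset.coe_add]; abel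
      _ ≤ darts next opp (next (opp d)) a + darts next opp (next (next (opp d))) b :=
          add_le_add ha.leafDarts_le hb.leafDarts_le
      _ ≤ {d} + {opp d} + (darts next opp (next (opp d)) a +
            darts next opp (next (next (opp d))) b) := Multiset.le_add_left _ _
      _ = darts next opp d (a * b) := by simp only [darts, add_assoc]
  eq_of_flip next' hU hQ := by
    simp only [Multiset.mem_add, Multiset.mem_singleton, or_imp, forall_and, forall_eq] at hU hQ
    obtain ⟨hda, hla⟩ := ha.eq_of_flip next' (by tauto) (by tauto)
    obtain ⟨hdb, hlb⟩ := hb.eq_of_flip next' (by tauto) (by tauto)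
    simp only [darts, leafDarts, hU, hda, hla, hdb, hlb, and_self]

variable {y : D}

theorem left (next_next_next : ∀ d, next (next (next d)) = d) (opp_opp : ∀ d, opp (opp d) = d)
    (hy : y = next (next (opp d)))
    (ha : Realizes next opp (next (opp d)) a a' U Q)
    (hb : Realizes next opp (next (opp y)) b b' U' Q')
    (hc : Realizes next opp (next (next (opp y))) c c' U'' Q'') :
    Realizes next opp d (a * (b * c)) (a' * b' * c') (U + U' + U'')
      ({y} + {opp y} + (Q + Q' + Q'')) := by
  have hy1 : next y = opp d := by rw [hy, next_next_next]
  have hdarts : darts next opp d (a * (b * c)) = {d} + {opp d} + darts next opp (next (opp d)) a +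
      ({y} + {opp y} + darts next opp (next (opp y)) b +
        darts next opp (next (next (opp y))) c) := by simp only [darts, hy]
  refine ⟨?_, ?_, ?_, ?_⟩
  · simp only [hdarts, ha.darts_eq, hb.darts_eq, hc.darts_eq, Multiset.add_bind,
      Multiset.singleton_bind, tri, hy1]
    abel
  · simp only [Multiset.mem_add, Multiset.mem_singleton]
    rintro x ((rfl | rfl) | (hx | hx) | hx)
    exacts [.inl (.inr rfl), .inl (.inl (opp_opp y)), .inr (.inl (.inl (ha.opp_mem x hx))),
      .inr (.inl (.inr (hb.opp_mem x hx))), .inr (.inr (hc.opp_mem x hx))]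
  · have hleaf := add_le_add (add_le_add ha.leafDarts_le hb.leafDarts_le) hc.leafDarts_le
    simp only [hdarts, leafDarts, ← hy, ← Multiset.coe_add]
    refine le_trans (le_of_eq ?_) ((add_le_add_right hleaf ({y} + {opp y})).trans
      ((Multiset.le_add_left _ ({d} + {opp d})).trans (le_of_eq ?_))) <;> abel
  · intro next' hU hQ
    simp only [Multiset.mem_add, Multiset.mem_singleton, or_imp, forall_and, forall_eq, opp_opp,
      hy1] at hU hQ
    obtain ⟨hda, hla⟩ := ha.eq_of_flip next' (by tauto) (by tauto)
    obtain ⟨hdb, hlb⟩ := hb.eq_of_flip next' (by tauto) (by tauto)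
    obtain ⟨hdc, hlc⟩ := hc.eq_of_flip next' (by tauto) (by tauto)
    rw [hdarts]
    simp only [darts, leafDarts, hQ, ← hy, hda, hla, hdb, hlb, hdc, hlc, List.append_assoc,
      and_true]
    abel

theorem right (next_next_next : ∀ d, next (next (next d)) = d) (opp_opp : ∀ d, opp (opp d) = d)
    (hy : y = next (opp d))
    (ha : Realizes next opp (next (opp y)) a a' U Q)
    (hb : Realizes next opp (next (next (opp y))) b b' U' Q')
    (hc : Realizes next opp (next y) c c' U'' Q'') :
    Realizes next opp d (a * b * c) (a' * (b' * c')) (U + U' + U'')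
      ({y} + {opp y} + (Q + Q' + Q'')) := by
  have hy2 : next (next y) = opp d := by rw [hy, next_next_next]
  have hdarts : darts next opp d (a * b * c) = {d} + {opp d} +
      ({y} + {opp y} + darts next opp (next (opp y)) a + darts next opp (next (next (opp y))) b) +
        darts next opp (next y) c := by simp only [darts, hy]
  refine ⟨?_, ?_, ?_, ?_⟩
  · simp only [hdarts, ha.darts_eq, hb.darts_eq, hc.darts_eq, Multiset.add_bind,
      Multiset.singleton_bind, tri, hy2]
    abel
  · simp only [Multiset.mem_add, Multiset.mem_singleton]
    rintro x ((rfl | rfl) | (hx | hx) | hx)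
    exacts [.inl (.inr rfl), .inl (.inl (opp_opp y)), .inr (.inl (.inl (ha.opp_mem x hx))),
      .inr (.inl (.inr (hb.opp_mem x hx))), .inr (.inr (hc.opp_mem x hx))]
  · have hleaf := add_le_add (add_le_add ha.leafDarts_le hb.leafDarts_le) hc.leafDarts_le
    simp only [hdarts, leafDarts, ← hy, ← Multiset.coe_add]
    refine le_trans (le_of_eq ?_) ((add_le_add_right hleaf ({y} + {opp y})).trans
      ((Multiset.le_add_left _ ({d} + {opp d})).trans (le_of_eq ?_))) <;> abel
  · intro next' hU hQ
    simp only [Multiset.mem_add, Multiset.mem_singleton, or_imp, forall_and, forall_eq, opp_opp,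
      hy2] at hU hQ
    obtain ⟨hda, hla⟩ := ha.eq_of_flip next' (by tauto) (by tauto)
    obtain ⟨hdb, hlb⟩ := hb.eq_of_flip next' (by tauto) (by tauto)
    obtain ⟨hdc, hlc⟩ := hc.eq_of_flip next' (by tauto) (by tauto)
    rw [hdarts]
    simp only [darts, leafDarts, hQ, ← hy, hda, hla, hdb, hlb, hdc, hlc, opp_opp,
      List.append_assoc, and_true]
    abel

end Realizes

theorem SimRot.exists_realizes {next opp : D → D} (next_next_next : ∀ d, next (next (next d)) = d)
    (opp_opp : ∀ d, opp (opp d) = d) {t t' : FreeMagma α} (h : SimRot t t') (d : D) :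
    ∃ U Q, Realizes next opp d t t' U Q := by
  induction h generalizing d with
  | of i => exact ⟨_, _, .of d i⟩
  | mul _ _ iha ihb =>
    obtain ⟨U, Q, ha⟩ := iha (next (opp d))
    obtain ⟨U', Q', hb⟩ := ihb (next (next (opp d)))
    exact ⟨_, _, ha.mul hb⟩
  | left _ _ _ iha ihb ihc =>
    set y := next (next (opp d)) with hy
    obtain ⟨U, Q, ha⟩ := iha (next (opp d))
    obtain ⟨U', Q', hb⟩ := ihb (next (opp y))
    obtain ⟨U'', Q'', hc⟩ := ihc (next (next (opp y)))
    exact ⟨_, _, .left next_next_next opp_opp hy ha hb hc⟩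
  | right _ _ _ iha ihb ihc =>
    set y := next (opp d) with hy
    obtain ⟨U, Q, ha⟩ := iha (next (opp y))
    obtain ⟨U', Q', hb⟩ := ihb (next (next (opp y)))
    obtain ⟨U'', Q'', hc⟩ := ihc (next y)
    exact ⟨_, _, .right next_next_next opp_opp hy ha hb hc⟩

section Closure

variable {next opp : D → D}

theorem mem_tri_self (x : D) : x ∈ tri next x := by simp [tri]

theorem eq_of_mem_tri {P : Multiset D} (hP : (P.bind (tri next)).Nodup) {x x' y : D} (hx : x ∈ P)
    (hx' : x' ∈ P) (hy : y ∈ tri next x) (hy' : y ∈ tri next x') : x = x' := by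
  by_contra hne
  obtain ⟨P, rfl⟩ := Multiset.exists_cons_of_mem hx
  have hx' : x' ∈ P := (Multiset.mem_cons.1 hx').resolve_left (Ne.symm hne)
  rw [Multiset.cons_bind, Multiset.nodup_add] at hP
  exact Multiset.disjoint_left.1 hP.2.2 hy (Multiset.mem_bind.2 ⟨x', hx', hy'⟩)

theorem next_mem_darts (next_next_next : ∀ d, next (next (next d)) = d)
    (opp_opp : ∀ d, opp (opp d) = d) {d x : D} {t : FreeMagma α} (hd : next d = d)
    (hx : x ∈ darts next opp d t) : next x ∈ darts next opp d t := by
  obtain ⟨U, Q, h⟩ := (SimRot.refl t).exists_realizes next_next_next opp_opp d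
  rw [h.darts_eq, Multiset.mem_add, Multiset.mem_singleton, Multiset.mem_bind] at hx ⊢
  rcases hx with rfl | ⟨y, hy, hx⟩
  · exact .inl hd
  · refine .inr ⟨y, hy, ?_⟩
    simp only [tri, Multiset.mem_add, Multiset.mem_singleton] at hx ⊢
    rcases hx with (rfl | rfl) | rfl <;> simp [next_next_next]

theorem mem_darts_of_mem_leafDarts (next_next_next : ∀ d, next (next (next d)) = d)
    (opp_opp : ∀ d, opp (opp d) = d) {d x : D} {t : FreeMagma α}
    (hx : x ∈ leafDarts next opp d t) : x ∈ darts next opp d t := by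
  obtain ⟨U, Q, h⟩ := (SimRot.refl t).exists_realizes next_next_next opp_opp d
  exact Multiset.mem_of_le h.leafDarts_le (Multiset.mem_add.2 (.inl hx))

end Closure

theorem FlipAlong.root_eq {S : Set D} {T T' : Triangulation n D} (h : FlipAlong S T T') :
    T'.root = T.root := by
  obtain ⟨hroot, -, -, -, hnext, -, -⟩ := h
  by_contra hne
  refine T'.next_ne _ (Ne.symm hne) ?_
  rw [hnext, T.next_root] <;> simpa only [T.next_root] using hroot

namespace Triangulation

/-- Developing `T` from its boundary curve in the shape of the tree `t` meets each dart exactly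
once. The surface is then a polygon, whose sides are the boundary curve and the leaves of `t`, with
the latter glued in pairs. -/
structure Develops (T : Triangulation n D) (t : FreeMagma α) : Prop where
  nodup : (darts T.next T.opp T.root t).Nodup
  mem : ∀ d, d ∈ darts T.next T.opp T.root t

/-- The sides of the polygon obtained by developing `T` in the shape of `t`, other than the boundary
curve. -/
def sides (T : Triangulation n D) (t : FreeMagma α) : List D :=
  leafDarts T.next T.opp T.root t

namespace Develops

variable {T : Triangulation n D} {T' : Triangulation n E} {t t' : FreeMagma α}

theorem length_eq [Finite D] (hT : T.Develops t) : t.length = 2 * n := by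
  have := Fintype.ofFinite D
  have hcard : Nat.card D = (darts T.next T.opp T.root t).card := by
    rw [Nat.card_eq_fintype_card, ← Finset.card_univ,
      ← Finset.eq_univ_iff_forall (s := ⟨_, hT.nodup⟩).2 hT.mem, Finset.card_mk]
  have := FlipDisk.card_darts (next := T.next) (opp := T.opp) T.root t
  have := T.card_darts
  omega

theorem flippable (hT : T.Develops t) {U Q : Multiset D}
    (h : Realizes T.next T.opp T.root t t' U Q) : T.Flippable {x | x ∈ Q} := by
  have hnodup := h.darts_eq ▸ hT.nodup
  rw [Multiset.nodup_add] at hnodup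
  obtain ⟨-, hbind, hroot⟩ := hnodup
  have hroot : T.root ∉ Q := fun hQ =>
    Multiset.disjoint_left.1 hroot (Multiset.mem_singleton_self _)
      (Multiset.mem_bind.2 ⟨_, Multiset.mem_add.2 (.inr hQ), mem_tri_self _⟩)
  have hne {x : D} (hx : x ∈ Q) : T.next x ≠ x := T.next_ne x fun h => hroot (h ▸ hx)
  have heq {x y : D} (hx : x ∈ Q) (hy : y ∈ Q) (hyx : y ∈ tri T.next x) : y = x :=
    eq_of_mem_tri hbind (Multiset.mem_add.2 (.inr hy)) (Multiset.mem_add.2 (.inr hx))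
      (mem_tri_self _) hyx
  refine ⟨hroot, h.opp_mem, fun x hx hx' => hne hx (heq hx hx' (by simp [tri])),
    fun x hx hx' => hne hx ?_⟩
  conv_rhs => rw [← T.next_next_next x, heq hx hx' (by simp [tri])]

theorem exists_flipAlong [Finite D] (hT : T.Develops t) (h : SimRot t t') :
    ∃ S T', FlipAlong S T T' ∧ T'.Develops t' ∧ T'.sides t' = T.sides t ∧
      ∀ d ∈ T.sides t, T'.vert d = T.vert d := by
  obtain ⟨U, Q, h⟩ := h.exists_realizes T.next_next_next T.opp_opp T.root
  obtain ⟨T', hflip⟩ := (hT.flippable h).exists_flipAlong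
  have hdisj : Disjoint (U.bind (tri T.next)) Q := by
    have hnodup := h.darts_eq ▸ hT.nodup
    rw [Multiset.nodup_add, Multiset.add_bind, Multiset.nodup_add] at hnodup
    exact Multiset.disjoint_left.2 fun hU hQ => Multiset.disjoint_left.1 hnodup.2.1.2.2 hU
      (Multiset.mem_bind.2 ⟨_, hQ, mem_tri_self _⟩)
  have hU {x y : D} (hx : x ∈ U) (hy : y ∈ tri T.next x) : y ∉ Q :=
    Multiset.disjoint_left.1 hdisj (Multiset.mem_bind.2 ⟨x, hx, hy⟩)
  have hleaf : ∀ x ∈ T.sides t, x ∉ Q := fun x hx hQ => Multiset.disjoint_left.1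
    (Multiset.nodup_add.1 (Multiset.nodup_of_le h.leafDarts_le hT.nodup)).2.2 hx hQ
  obtain ⟨-, -, hopp, hS, hnext, -, hvert⟩ := id hflip
  have hkeep : ∀ x ∈ U, T'.next x = T.next x ∧ T'.next (T.next x) = T.next (T.next x) := by
    refine fun x hx => ⟨hnext x ?_ ?_ ?_, hnext _ ?_ ?_ ?_⟩ <;>
      exact hU hx (by simp [tri, T.next_next_next])
  obtain ⟨hdarts, hleafDarts⟩ := h.eq_of_flip T'.next hkeep hS
  refine ⟨_, T', hflip, ⟨?_, ?_⟩, ?_, fun x hx => hvert x (hleaf x hx)⟩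
  · rw [hopp, hflip.root_eq, hdarts]; exact hT.nodup
  · rw [hopp, hflip.root_eq, hdarts]; exact hT.mem
  · rw [sides, sides, hopp, hflip.root_eq, hleafDarts]

end Develops

end Triangulation

theorem exists_equiv_of_pairs {P : Multiset (D × E)} (hD : (P.map Prod.fst).Nodup)
    (hD' : ∀ d, d ∈ P.map Prod.fst) (hE : (P.map Prod.snd).Nodup) (hE' : ∀ d, d ∈ P.map Prod.snd) :
    ∃ e : D ≃ E, ∀ p, p ∈ P ↔ e p.1 = p.2 := by
  have hfst : Function.Bijective fun p : {p // p ∈ P} => p.1.1 := by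
    refine ⟨fun p q h => Subtype.ext (Multiset.inj_on_of_nodup_map hD _ p.2 _ q.2 h), fun d => ?_⟩
    obtain ⟨p, hp, rfl⟩ := Multiset.mem_map.1 (hD' d)
    exact ⟨⟨p, hp⟩, rfl⟩
  have hsnd : Function.Bijective fun p : {p // p ∈ P} => p.1.2 := by
    refine ⟨fun p q h => Subtype.ext (Multiset.inj_on_of_nodup_map hE _ p.2 _ q.2 h), fun d => ?_⟩
    obtain ⟨p, hp, rfl⟩ := Multiset.mem_map.1 (hE' d)
    exact ⟨⟨p, hp⟩, rfl⟩
  have he (p : {p // p ∈ P}) :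
      (Equiv.ofBijective _ hfst).symm.trans (Equiv.ofBijective _ hsnd) p.1.1 = p.1.2 :=
    congrArg (fun p => p.1.2) ((Equiv.ofBijective _ hfst).symm_apply_apply p)
  refine ⟨(Equiv.ofBijective _ hfst).symm.trans (Equiv.ofBijective _ hsnd),
    fun p => ⟨fun hp => he ⟨p, hp⟩, fun hp => ?_⟩⟩
  obtain ⟨q, hq, hqp⟩ := Multiset.mem_map.1 (hD' p.1)
  have : q = p := Prod.ext hqp ((he ⟨q, hq⟩).symm.trans (by rw [← hp, hqp]))
  exact this ▸ hq

theorem vert_eq_of_mem_darts {T : Triangulation n D} {T' : Triangulation n E} {d : D × E}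
    {t : FreeMagma α}
    (h : ∀ p ∈ leafDarts (Prod.map T.next T'.next) (Prod.map T.opp T'.opp) d t,
      T'.vert p.2 = T.vert p.1 ∧ T'.vert (T'.opp p.2) = T.vert (T.opp p.1)) :
    ∀ p ∈ darts (Prod.map T.next T'.next) (Prod.map T.opp T'.opp) d t,
      T'.vert p.2 = T.vert p.1 := by
  let C (p : D × E) : Prop :=
    T'.vert p.2 = T.vert p.1 ∧ T'.vert (T'.opp p.2) = T.vert (T.opp p.1)
  have hopp (p : D × E) (hp : C (Prod.map T.opp T'.opp p)) : C p :=
    ⟨by simpa only [Prod.map_fst, Prod.map_snd, T.opp_opp, T'.opp_opp] using hp.2, hp.1⟩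
  have hnext (p : D × E) (hp : C (Prod.map T.next T'.next p))
      (hp' : C (Prod.map T.next T'.next (Prod.map T.next T'.next p))) : C p := by
    refine ⟨?_, by simpa only [Prod.map_fst, Prod.map_snd, T.vert_next, T'.vert_next] using hp.1⟩
    simpa only [Prod.map_fst, Prod.map_snd, ← T.vert_next, ← T'.vert_next, T.next_next_next,
      T'.next_next_next] using hp'.2
  exact fun p hp => (forall_mem_darts hopp hnext h p hp).1

theorem Triangulation.Develops.orientedIso {T : Triangulation n D} {T' : Triangulation n E}
    {t : FreeMagma α} (hT : T.Develops t) (hT' : T'.Develops t)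
    (hopp : ∀ p ∈ (T.sides t).zip (T'.sides t),
      (T.opp p.1, T'.opp p.2) ∈ (T.sides t).zip (T'.sides t))
    (hvert : ∀ p ∈ (T.sides t).zip (T'.sides t), T'.vert p.2 = T.vert p.1) :
    OrientedIso T T' := by
  set next := Prod.map T.next T'.next
  set opp := Prod.map T.opp T'.opp
  have next_next_next (p) : next (next (next p)) = p :=
    Prod.ext (T.next_next_next p.1) (T'.next_next_next p.2)
  have opp_opp (p) : opp (opp p) = p := Prod.ext (T.opp_opp p.1) (T'.opp_opp p.2)
  set P := darts next opp (T.root, T'.root) t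
  have hfst : P.map Prod.fst = darts T.next T.opp T.root t :=
    map_darts (f := Prod.fst) (fun _ => rfl) (fun _ => rfl) _ _
  have hsnd : P.map Prod.snd = darts T'.next T'.opp T'.root t :=
    map_darts (f := Prod.snd) (fun _ => rfl) (fun _ => rfl) _ _
  have hleaf : leafDarts next opp (T.root, T'.root) t = (T.sides t).zip (T'.sides t) :=
    List.zip_of_prod (map_leafDarts (f := Prod.fst) (fun _ => rfl) (fun _ => rfl) _ _)
      (map_leafDarts (f := Prod.snd) (fun _ => rfl) (fun _ => rfl) _ _)
  obtain ⟨e, he⟩ := exists_equiv_of_pairs (P := P) (hfst ▸ hT.nodup) (hfst ▸ hT.mem)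
    (hsnd ▸ hT'.nodup) (hsnd ▸ hT'.mem)
  have hmem (d : D) : (d, e d) ∈ P := (he _).2 rfl
  have hnextP (d : D) : next (d, e d) ∈ P := next_mem_darts next_next_next opp_opp
    (Prod.ext T.next_root T'.next_root) (hmem d)
  have hoppP (d : D) : opp (d, e d) ∈ P :=
    (opp_mem_darts_or_mem_leafDarts opp_opp (hmem d)).elim id fun h =>
      mem_darts_of_mem_leafDarts next_next_next opp_opp (hleaf ▸ hopp (d, e d) (hleaf ▸ h))
  have hvertP := vert_eq_of_mem_darts (T := T) (T' := T') (d := (T.root, T'.root)) (t := t)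
    fun p hp => ⟨hvert p (hleaf ▸ hp), hvert _ (hopp p (hleaf ▸ hp))⟩
  exact ⟨e, fun d => ⟨((he _).1 (hnextP d)).symm, ((he _).1 (hoppP d)).symm, hvertP _ (hmem d)⟩⟩

/-! ### Existence of developments -/

section Extend

variable {next opp : D → D}

theorem nodup_tri (next_next_next : ∀ d, next (next (next d)) = d) {d : D} (hd : next d ≠ d) :
    (tri next d).Nodup := by
  have h₁ : next (next d) ≠ next d := fun h =>
    hd ((h.symm.trans (congrArg next h).symm).trans (next_next_next d))
  have h₂ : next (next d) ≠ d := fun h => hd <| by rw [← h, next_next_next, h]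
  simp [tri, hd.symm, h₁.symm, h₂.symm]

theorem exists_extend {d x : D} {t : FreeMagma α} (hx : x ∈ leafDarts next opp d t) :
    ∃ t' : FreeMagma α, darts next opp d t' = darts next opp d t + tri next (opp x) ∧
      (leafDarts next opp d t' : Multiset D) + {x} =
        leafDarts next opp d t + {next (opp x)} + {next (next (opp x))} := by
  induction t generalizing d with
  | ih1 a =>
    obtain rfl : x = d := by simpa only [leafDarts, List.mem_singleton] using hx
    refine ⟨of a * of a, by simp only [darts, tri]; abel, ?_⟩
    simp only [leafDarts, ← Multiset.coe_add, Multiset.coe_singleton]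
    abel
  | ih2 l r hl hr =>
    simp only [leafDarts, List.mem_append] at hx
    rcases hx with hx | hx
    · obtain ⟨l', hdarts, hleaf⟩ := hl hx
      refine ⟨l' * r, by simp only [darts, hdarts]; abel, ?_⟩
      simp only [leafDarts, ← Multiset.coe_add]
      rw [add_right_comm, hleaf]
      abel
    · obtain ⟨r', hdarts, hleaf⟩ := hr hx
      refine ⟨l * r', by simp only [darts, hdarts]; abel, ?_⟩
      simp only [leafDarts, ← Multiset.coe_add]
      rw [add_assoc, hleaf]
      abel

end Extend

namespace Triangulation

/-- The triangles met when developing `T` in the shape of `t` are different, and no arc in `K` is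
crossed. -/
structure DevelopsOff (T : Triangulation n D) (K : Set D) (t : FreeMagma α) : Prop where
  nodup : (darts T.next T.opp T.root t).Nodup
  mem_sides : ∀ x ∈ darts T.next T.opp T.root t, x ∈ K → x ∈ T.sides t

namespace DevelopsOff

variable {T : Triangulation n D} {K : Set D} {t : FreeMagma α}

theorem next_mem {x : D} (hx : x ∈ darts T.next T.opp T.root t) :
    T.next x ∈ darts T.next T.opp T.root t :=
  next_mem_darts T.next_next_next T.opp_opp T.next_root hx

theorem exists_extend (ht : T.DevelopsOff K t) (hK : ∀ x ∈ K, T.opp x ∈ K) {x : D}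
    (hx : x ∈ T.sides t) (hxK : x ∉ K) (hopp : T.opp x ∉ darts T.next T.opp T.root t) :
    ∃ t' : FreeMagma α, T.DevelopsOff K t' ∧ t.length < t'.length := by
  obtain ⟨t', hdarts, hleaf⟩ := FlipDisk.exists_extend hx
  refine ⟨t', ⟨?_, fun y hy hyK => ?_⟩, ?_⟩
  · have hne : T.next (T.opp x) ≠ T.opp x :=
      T.next_ne _ fun h => hopp (h ▸ mem_darts_self _ _)
    rw [hdarts, Multiset.nodup_add]
    refine ⟨ht.nodup, nodup_tri T.next_next_next hne,
      Multiset.disjoint_left.2 fun {y} hy hy' => hopp ?_⟩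
    simp only [tri, Multiset.mem_add, Multiset.mem_singleton] at hy'
    rcases hy' with (rfl | rfl) | rfl
    · exact hy
    · exact T.next_next_next (T.opp x) ▸ next_mem (next_mem hy)
    · exact T.next_next_next (T.opp x) ▸ next_mem hy
  · have hyx : y ≠ x := fun h => hxK (h ▸ hyK)
    have hyox : y ≠ T.opp x := fun h => hxK (T.opp_opp x ▸ hK _ (h ▸ hyK))
    have hmem : y ∈ (T.sides t' : Multiset D) + {x} := by
      simp only [hdarts, tri, Multiset.mem_add, Multiset.mem_singleton] at hy
      simp only [sides, hleaf, Multiset.mem_add, Multiset.mem_singleton]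
      rcases hy with hy | (hy | hy) | hy
      · exact .inl (.inl (ht.mem_sides y hy hyK))
      · exact absurd hy hyox
      · exact .inl (.inr hy)
      · exact .inr hy
    exact (Multiset.mem_add.1 hmem).resolve_right (by simpa using hyx)
  · have hlen := congrArg Multiset.card hleaf
    simp only [Multiset.card_add, Multiset.coe_card, length_leafDarts, Multiset.card_singleton]
      at hlen
    omega

theorem exists_opp_mem [Finite D] (ht : T.DevelopsOff K t) (hK : ∀ x ∈ K, T.opp x ∈ K) :
    ∃ t' : FreeMagma α, T.DevelopsOff K t' ∧
      ∀ x ∈ T.sides t', x ∉ K → T.opp x ∈ darts T.next T.opp T.root t' := by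
  have := Fintype.ofFinite D
  set L : Set ℕ := {k | ∃ t : FreeMagma α, T.DevelopsOff K t ∧ t.length = k}
  have hL : BddAbove L := by
    refine ⟨Fintype.card D, ?_⟩
    rintro _ ⟨t, ht, rfl⟩
    have hle : (darts T.next T.opp T.root t).card ≤ Fintype.card D :=
      Finset.card_le_univ ⟨_, ht.nodup⟩
    have := FlipDisk.card_darts (next := T.next) (opp := T.opp) T.root t
    have := t.length_pos
    omega
  obtain ⟨t', ht', hlen⟩ := Nat.sSup_mem (s := L) ⟨_, t, ht, rfl⟩ hL
  refine ⟨t', ht', fun x hx hxK => by_contra fun hopp => ?_⟩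
  obtain ⟨t'', ht'', hlt⟩ := ht'.exists_extend hK hx hxK hopp
  exact absurd (le_csSup hL ⟨t'', ht'', rfl⟩) (by omega)

end DevelopsOff

/-- If the surface stays connected when it is cut along the arcs in `K`, then these are among the
sides of a polygon to which the surface can be developed. -/
theorem exists_develops [Finite D] (T : Triangulation n D) {K : Set D}
    (hK : ∀ x ∈ K, T.opp x ∈ K)
    (hconn : ∀ C : Set D, T.root ∈ C → (∀ x ∈ C, T.next x ∈ C) →
      (∀ x ∈ C, x ∉ K → T.opp x ∈ C) → ∀ x, x ∈ C) :
    ∃ t : FreeMagma Unit, T.Develops t ∧ ∀ x ∈ K, x ∈ T.sides t := by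
  have hof : T.DevelopsOff K (of ()) := ⟨by simp [darts], by simp [darts, sides, leafDarts]⟩
  obtain ⟨t, ht, hsides⟩ := hof.exists_opp_mem hK
  have hmem := hconn {x | x ∈ darts T.next T.opp T.root t} (mem_darts_self _ _)
    (fun x hx => DevelopsOff.next_mem hx) fun x hx hxK =>
      (opp_mem_darts_or_mem_leafDarts T.opp_opp hx).elim id fun h => hsides x h hxK
  exact ⟨t, ⟨ht.nodup, hmem⟩, fun x hx => ht.mem_sides x (hmem x) hx⟩

theorem exists_develops_empty [Finite D] (T : Triangulation n D) :
    ∃ t : FreeMagma Unit, T.Develops t := by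
  obtain ⟨t, ht, -⟩ := T.exists_develops (K := ∅) (by simp) fun C hroot hnext hopp =>
    T.mem_of_closed hroot hnext fun x hx => hopp x hx (Set.notMem_empty x)
  exact ⟨t, ht⟩

end Triangulation

/-! ### Stars -/

/-- The sides of a polygon glued along arcs with a common initial point, the darts `L`. -/
def starSides (opp : D → D) (L : List D) : List D :=
  L.flatMap fun x => [x, opp x]

theorem length_starSides (opp : D → D) (L : List D) :
    (starSides opp L).length = 2 * L.length := by
  induction L with
  | nil => rfl
  | cons x L ih =>
    rw [starSides, List.flatMap_cons, List.length_append, ← starSides, ih, List.length_cons]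
    simp only [List.length_cons, List.length_nil]
    ring

theorem mem_starSides {opp : D → D} (opp_opp : ∀ d, opp (opp d) = d) {L : List D} {x : D} :
    x ∈ starSides opp L ↔ x ∈ L ∨ opp x ∈ L := by
  simp only [starSides, List.mem_flatMap, List.mem_cons, List.not_mem_nil, or_false]
  constructor
  · rintro ⟨y, hy, rfl | rfl⟩
    exacts [.inl hy, .inr ((opp_opp y).symm ▸ hy)]
  · rintro (hx | hx)
    exacts [⟨x, hx, .inl rfl⟩, ⟨opp x, hx, .inr (opp_opp x).symm⟩]

theorem zip_starSides (opp : D → D) (opp' : E → E) {L : List D} {L' : List E}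
    (h : L.length = L'.length) :
    (starSides opp L).zip (starSides opp' L') = starSides (Prod.map opp opp') (L.zip L') := by
  refine (List.zip_of_prod ?_ ?_).symm
  · conv_rhs => rw [← List.map_fst_zip h.le]
    simp [starSides, List.map_flatMap, List.flatMap_map]
  · conv_rhs => rw [← List.map_snd_zip h.ge]
    simp [starSides, List.map_flatMap, List.flatMap_map]

namespace Triangulation

theorem vert_adjacent_of_mem_darts_comb (T : Triangulation n D) (w : FreeSemigroup α) {d : D}
    (hd : T.vert (T.opp d) = none) : ∀ x ∈ darts T.next T.opp d (comb w),
      T.vert x = none ∨ ∃ y, T.vert y = none ∧ T.vert (T.opp y) = T.vert x := by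
  have hadj : ∃ y, T.vert y = none ∧ T.vert (T.opp y) = T.vert d :=
    ⟨T.opp d, hd, by rw [T.opp_opp]⟩
  induction w generalizing d with
  | ih1 a =>
    rintro x hx
    obtain rfl : x = d := Multiset.mem_singleton.1 hx
    exact .inr hadj
  | ih2 a w _ ih =>
    have hcomb : comb (FreeSemigroup.of a * w) = of a * comb w := rfl
    simp only [hcomb, darts, Multiset.mem_add, Multiset.mem_singleton]
    rintro x (((rfl | rfl) | rfl) | hx)
    · exact .inr hadj
    · exact .inl hd
    · exact .inr (by rwa [T.vert_next_opp])
    · have hd' : T.vert (T.opp (T.next (T.next (T.opp d)))) = none := by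
        rw [← T.vert_next, T.next_next_next, hd]
      exact ih hd' ⟨_, hd', by rw [T.opp_opp]⟩ x hx

/-- The endpoints of the darts in a list form a path. -/
def IsPath (T : Triangulation n D) : Option (Fin n) → List D → Option (Fin n) → Prop
  | u, [], w => u = w
  | u, x :: L, w => T.vert x = u ∧ T.IsPath (T.vert (T.opp x)) L w

theorem IsPath.append {T : Triangulation n D} {u v w : Option (Fin n)} {L L' : List D}
    (h : T.IsPath u L v) (h' : T.IsPath v L' w) : T.IsPath u (L ++ L') w := by
  induction L generalizing u with
  | nil => exact (show u = v from h) ▸ h'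
  | cons x L ih => exact ⟨h.1, ih h.2⟩

theorem isPath_leafDarts (T : Triangulation n D) (d : D) (t : FreeMagma α) :
    T.IsPath (T.vert d) (leafDarts T.next T.opp d t) (T.vert (T.opp d)) := by
  induction t generalizing d with
  | ih1 => exact ⟨rfl, rfl⟩
  | ih2 l r hl hr =>
    have hleft := hl (T.next (T.opp d))
    have hright := hr (T.next (T.next (T.opp d)))
    rw [← T.vert_next (T.next (T.opp d)), T.vert_next_opp] at hleft
    rw [← T.vert_next (T.next (T.next (T.opp d))), T.next_next_next] at hright
    exact hleft.append hright

theorem isPath_sides (T : Triangulation n D) (t : FreeMagma α) :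
    T.IsPath none (T.sides t) none := by
  have h := T.isPath_leafDarts T.root t
  rwa [← T.vert_next, T.next_root, T.vert_root] at h

/-- The dart `x` runs from the boundary marked point to the interior marked point `w`. -/
def IsSpoke (T : Triangulation n D) (x : D) (w : Fin n) : Prop :=
  T.vert x = none ∧ T.vert (T.opp x) = some w

/-- A choice of one spoke `e w` for every interior marked point `w`. -/
def IsSpokes (T : Triangulation n D) (e : Fin n → D) : Prop :=
  ∀ w, T.IsSpoke (e w) w

namespace IsSpokes

variable {T : Triangulation n D} {e : Fin n → D} {t : FreeMagma α}

theorem injective (he : T.IsSpokes e) : Function.Injective e := fun v w h =>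
  Option.some_injective _ <| by rw [← (he v).2, h, (he w).2]

theorem ne_opp (he : T.IsSpokes e) (v w : Fin n) : e v ≠ T.opp (e w) := fun h => by
  have := (he w).2
  rw [← h, (he v).1] at this
  cases this

theorem opp_mem_iff [Finite D] (he : T.IsSpokes e) {C : Set D} (hnext : ∀ x ∈ C, T.next x ∈ C)
    (hopp : ∀ x, (∀ w, x ≠ e w ∧ x ≠ T.opp (e w)) → (T.opp x ∈ C ↔ x ∈ C)) (w : Fin n) :
    e w ∈ C ↔ T.opp (e w) ∈ C := by
  have hnext' (x : D) : T.next x ∈ C ↔ x ∈ C :=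
    ⟨fun hx => T.next_next_next x ▸ hnext _ (hnext _ hx), hnext x⟩
  have hturn : (T.next * T.opp) (T.opp (e w)) ∈ C ↔ T.opp (e w) ∈ C := by
    refine mem_iff_of_forall_ne fun y hy hne => ?_
    have hvert : T.vert y = some w := ((T.vert_eq_iff _ _).2 hy).symm.trans (he w).2
    rw [Perm.mul_apply, hnext']
    refine hopp y fun w' => ⟨?_, ?_⟩
    · rintro rfl
      simp only [(he w').1, reduceCtorEq] at hvert
    · rintro rfl
      obtain rfl : w' = w := Option.some_injective _ ((he w').2.symm.trans hvert)
      exact hne rfl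
  rwa [Perm.mul_apply, hnext', T.opp_opp] at hturn

theorem exists_develops [Finite D] (he : T.IsSpokes e) :
    ∃ t : FreeMagma Unit, T.Develops t ∧ ∀ w, e w ∈ T.sides t ∧ T.opp (e w) ∈ T.sides t := by
  set K : Set D := {x | ∃ w, x = e w ∨ x = T.opp (e w)}
  have hK : ∀ x ∈ K, T.opp x ∈ K := by
    rintro _ ⟨w, rfl | rfl⟩
    exacts [⟨w, .inr rfl⟩, ⟨w, .inl (T.opp_opp _)⟩]
  have hK' {x : D} (hx : x ∉ K) : T.opp x ∉ K := fun h => hx (T.opp_opp x ▸ hK _ h)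
  obtain ⟨t, ht, hsides⟩ := T.exists_develops hK fun C hroot hnext hopp => by
    have hoff {x : D} (hx : x ∉ K) : T.opp x ∈ C ↔ x ∈ C :=
      ⟨fun h => T.opp_opp x ▸ hopp _ h (hK' hx), fun h => hopp x h hx⟩
    have hon := he.opp_mem_iff hnext fun x hx =>
      hoff fun ⟨w, hw⟩ => hw.elim (hx w).1 (hx w).2
    refine T.mem_of_closed hroot hnext fun x hx => ?_
    by_cases hxK : x ∈ K
    · obtain ⟨w, rfl | rfl⟩ := hxK
      · exact (hon w).1 hx
      · rw [T.opp_opp]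
        exact (hon w).2 hx
    · exact hopp x hx hxK
  exact ⟨t, ht, fun w => ⟨hsides _ ⟨w, .inl rfl⟩, hsides _ ⟨w, .inr rfl⟩⟩⟩

theorem mem_sides [Finite D] (he : T.IsSpokes e) (ht : T.Develops t)
    (hsides : ∀ w, e w ∈ T.sides t ∧ T.opp (e w) ∈ T.sides t) {x : D} (hx : x ∈ T.sides t) :
    ∃ w, x = e w ∨ x = T.opp (e w) := by
  classical
  set f : Fin n ⊕ Fin n → D := Sum.elim e (T.opp ∘ e)
  have hf : Function.Injective f := he.injective.sumElim (T.opp.injective.comp he.injective)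
    he.ne_opp
  have himage : Finset.univ.image f = (T.sides t).toFinset := by
    refine Finset.eq_of_subset_of_card_le (fun x hx => ?_) ?_
    · obtain ⟨w | w, -, rfl⟩ := Finset.mem_image.1 hx
      exacts [List.mem_toFinset.2 (hsides w).1, List.mem_toFinset.2 (hsides w).2]
    · rw [Finset.card_image_of_injective _ hf, Finset.card_univ, Fintype.card_sum, Fintype.card_fin,
        ← two_mul, ← ht.length_eq, ← length_leafDarts (next := T.next) (opp := T.opp) T.root t]
      exact List.toFinset_card_le _
  obtain ⟨w | w, -, rfl⟩ := Finset.mem_image.1 (himage ▸ List.mem_toFinset.2 hx)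
  exacts [⟨w, .inl rfl⟩, ⟨w, .inr rfl⟩]

theorem exists_eq_starSides (he : T.IsSpokes e) : ∀ L : List D,
    (∀ x ∈ L, ∃ w, x = e w ∨ x = T.opp (e w)) → T.IsPath none L none →
      ∃ r : List (Fin n), L = starSides T.opp (r.map e)
  | [], _, _ => ⟨[], rfl⟩
  | x :: L, hL, ⟨hx, hpath⟩ => by
    obtain ⟨w, rfl | rfl⟩ := hL x List.mem_cons_self
    · rw [(he w).2] at hpath
      rcases L with _ | ⟨y, L⟩
      · cases hpath
      obtain ⟨hy, hpath⟩ := hpath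
      obtain ⟨v, rfl | rfl⟩ := hL y (by simp)
      · simp only [(he v).1, reduceCtorEq] at hy
      · obtain rfl : v = w := Option.some_injective _ ((he v).2.symm.trans hy)
        rw [T.opp_opp, (he v).1] at hpath
        obtain ⟨r, rfl⟩ := exists_eq_starSides he L (fun x hx => hL x (by simp [hx])) hpath
        exact ⟨v :: r, rfl⟩
    · simp only [(he w).2, reduceCtorEq] at hx

end IsSpokes

/-- The leaves of the development behind `d` of shape `t` are the two sides of each of a list of
spokes, which lead to the points in the list `r`. -/
def IsStarAt (T : Triangulation n D) (d : D) (t : FreeMagma α) (r : List (Fin n)) : Prop :=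
  ∃ L, leafDarts T.next T.opp d t = starSides T.opp L ∧ List.Forall₂ T.IsSpoke L r

/-- `T` develops in the shape of `t` to a polygon whose sides are glued to spokes, which lead to the
points in the list `r`. -/
def IsStar (T : Triangulation n D) (t : FreeMagma α) (r : List (Fin n)) : Prop :=
  T.Develops t ∧ T.IsStarAt T.root t r

theorem IsStar.length_eq [Finite D] {T : Triangulation n D} {t : FreeMagma α} {r : List (Fin n)}
    (h : T.IsStar t r) : r.length = n := by
  obtain ⟨hT, L, hleaf, hspokes⟩ := h
  have hlength := congrArg List.length hleaf
  rw [length_leafDarts, hT.length_eq, length_starSides, hspokes.length_eq] at hlength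
  omega

theorem IsSpokes.exists_isStar [Finite D] {T : Triangulation n D} {e : Fin n → D}
    (he : T.IsSpokes e) :
    ∃ (t : FreeMagma Unit) (r : List (Fin n)), T.IsStar t r ∧ r.Perm (List.finRange n) := by
  obtain ⟨t, ht, hsides⟩ := he.exists_develops
  obtain ⟨r, hr⟩ := he.exists_eq_starSides (T.sides t) (fun x hx => he.mem_sides ht hsides hx)
    (T.isPath_sides t)
  have hspokes : List.Forall₂ T.IsSpoke (r.map e) r :=
    List.forall₂_map_left_iff.2 (List.forall₂_same.2 fun w _ => he w)
  have hstar : T.IsStar t r := ⟨ht, r.map e, hr, hspokes⟩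
  have hmem (w : Fin n) : w ∈ r := by
    have hw := (mem_starSides T.opp_opp).1 (hr ▸ (hsides w).1)
    simp only [List.mem_map] at hw
    obtain ⟨v, hv, hvw⟩ | ⟨v, -, hvw⟩ := hw
    · exact he.injective hvw ▸ hv
    · exact absurd hvw (he.ne_opp v w)
  have hsub : (List.finRange n).Subperm r := (List.nodup_finRange n).subperm fun w _ => hmem w
  exact ⟨t, r, hstar, (hsub.perm_of_length_le (by simp [hstar.length_eq])).symm⟩

theorem exists_isStar [Finite D] (T : Triangulation n D)
    (h : ∀ x, T.vert x = none ∨ ∃ y, T.vert y = none ∧ T.vert (T.opp y) = T.vert x) :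
    ∃ (t : FreeMagma Unit) (r : List (Fin n)), T.IsStar t r ∧ r.Perm (List.finRange n) := by
  have hspoke (w : Fin n) : ∃ y, T.vert y = none ∧ T.vert (T.opp y) = some w := by
    obtain ⟨x, hx⟩ := T.vert_surjective (some w)
    exact hx ▸ (h x).resolve_left (by simp [hx])
  choose e he using hspoke
  exact IsSpokes.exists_isStar he

theorem forall₂_exists_of_forall₂ {R : D → α → Prop} {S : E → α → Prop} {l : List D} {l' : List E}
    {r : List α} (h : List.Forall₂ R l r) (h' : List.Forall₂ S l' r) :
    List.Forall₂ (fun x x' => ∃ w, R x w ∧ S x' w) l l' := by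
  induction h generalizing l' with
  | nil => cases h'; exact .nil
  | cons hx _ ih => cases h' with | cons hx' h' => exact .cons ⟨_, hx, hx'⟩ (ih h')

theorem IsStar.orientedIso {T : Triangulation n D} {T' : Triangulation n E} {t : FreeMagma α}
    {r : List (Fin n)} (h : T.IsStar t r) (h' : T'.IsStar t r) : OrientedIso T T' := by
  obtain ⟨hT, L, hL, hr⟩ := h
  obtain ⟨hT', L', hL', hr'⟩ := h'
  obtain ⟨hlength, hspokes⟩ := List.forall₂_iff_zip.1 (forall₂_exists_of_forall₂ hr hr')
  have hmem (p : D × E) : p ∈ (T.sides t).zip (T'.sides t) ↔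
      p ∈ L.zip L' ∨ (T.opp p.1, T'.opp p.2) ∈ L.zip L' := by
    rw [sides, sides, hL, hL', zip_starSides _ _ hlength,
      mem_starSides fun p => Prod.ext (T.opp_opp p.1) (T'.opp_opp p.2), Prod.map_apply']
  refine hT.orientedIso hT' (fun p hp => ?_) fun p hp => ?_
  · rw [hmem] at hp ⊢
    simpa only [T.opp_opp, T'.opp_opp] using hp.symm
  · obtain hp | hp := (hmem p).1 hp <;> obtain ⟨w, hx, hx'⟩ := hspokes hp
    · exact hx'.1.trans hx.1.symm
    · simpa only [T.opp_opp, T'.opp_opp] using hx'.2.trans hx.2.symm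

end Triangulation

/-! ### Sorting -/

/-- Move the elements with a given property to the end, in reverse order. -/
def pass (p : α → Bool) (r : List α) : List α :=
  r.filter (!p ·) ++ (r.filter p).reverse

theorem pass_cons (p : α → Bool) (a : α) (r : List α) :
    pass p (a :: r) = if p a then pass p r ++ [a] else a :: pass p r := by
  cases h : p a <;> simp [pass, h]

theorem pass_singleton (p : α → Bool) (a : α) : pass p [a] = [a] := by
  cases h : p a <;> simp [pass, h]

/-- Sort by the last `k` binary digits of the labels, the least significant digit first. The order
is not the numerical one, because each pass reverses a part of the list. -/
def radix : ℕ → List (Fin n) → List (Fin n)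
  | 0, r => r
  | k + 1, r => pass (fun w => w.val.testBit k) (radix k r)

theorem filter_pass_testBit (k c : ℕ) (r : List (Fin n)) :
    (pass (fun w => w.val.testBit k) r).filter (fun w => w.val / 2 ^ (k + 1) = c) =
      r.filter (fun w => w.val / 2 ^ k = 2 * c) ++
        (r.filter fun w => w.val / 2 ^ k = 2 * c + 1).reverse := by
  rw [pass, List.filter_append, List.filter_reverse, List.filter_filter, List.filter_filter]
  congr 1
  · refine List.filter_congr fun w _ => ?_
    rw [pow_succ, ← Nat.div_div_eq_div_mul, Nat.testBit_eq_decide_div_mod_eq, Bool.eq_iff_iff]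
    simp only [Bool.and_eq_true, Bool.not_eq_true', decide_eq_true_eq, decide_eq_false_iff_not]
    omega
  · congr 1
    refine List.filter_congr fun w _ => ?_
    rw [pow_succ, ← Nat.div_div_eq_div_mul, Nat.testBit_eq_decide_div_mod_eq, Bool.eq_iff_iff]
    simp only [Bool.and_eq_true, decide_eq_true_eq]
    omega

theorem filter_radix_eq {r r' : List (Fin n)} (h : r.Perm r') (k c : ℕ) :
    (radix k r).filter (fun w => w.val / 2 ^ k = c) =
      (radix k r').filter fun w => w.val / 2 ^ k = c := by
  induction k generalizing c with
  | zero =>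
    refine (h.filter _).eq_of_pairwise (le := fun _ _ => True) (fun a b ha hb _ _ => ?_)
      (List.pairwise_of_forall fun _ _ => trivial) (List.pairwise_of_forall fun _ _ => trivial)
    simp only [pow_zero, Nat.div_one, List.mem_filter, decide_eq_true_eq] at ha hb
    exact Fin.ext (ha.2.trans hb.2.symm)
  | succ k ih => rw [radix, radix, filter_pass_testBit, filter_pass_testBit, ih, ih]

theorem radix_eq_of_perm {k : ℕ} (hk : n ≤ 2 ^ k) {r r' : List (Fin n)} (h : r.Perm r') :
    radix k r = radix k r' := by
  have hzero (w : Fin n) : w.val / 2 ^ k = 0 := Nat.div_eq_of_lt (w.2.trans_le hk)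
  simpa only [hzero, decide_true, List.filter_true] using filter_radix_eq h k 0

/-! ### Rearranging a star -/

/-- A shape for a star with one more spoke than there are entries in the list. For an entry `true`,
a diagonal from the end of the spoke to the boundary marked point separates the two sides at the
spoke; for an entry `false`, a diagonal cuts off both of them together. -/
def beforeShape : List Bool → FreeMagma Unit
  | [] => of () * of ()
  | true :: l => of () * (of () * beforeShape l)
  | false :: l => (of () * of ()) * beforeShape l

/-- The shape that arises from `beforeShape` by cutting along the diagonals to the ends of the
spokes marked by `true` in place of these spokes. -/
def afterShape : List Bool → FreeMagma Unit
  | [] => of () * of ()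
  | true :: l => (afterShape l * of ()) * of ()
  | false :: l => (of () * of ()) * afterShape l

theorem length_beforeShape (l : List Bool) : (beforeShape l).length = 2 * (l.length + 1) := by
  induction l with
  | nil => rfl
  | cons b l ih =>
    cases b <;> simp only [beforeShape, FreeMagma.length, ih, List.length_cons] <;> ring

namespace Triangulation

namespace IsStarAt

variable {T : Triangulation n D} {d : D} {a b : α} {t : FreeMagma α} {r : List (Fin n)} {w : Fin n}

theorem pair_mul_iff : T.IsStarAt d ((of a * of b) * t) (w :: r) ↔
    T.IsSpoke (T.next (T.opp (T.next (T.opp d)))) w ∧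
      T.next (T.next (T.opp (T.next (T.opp d)))) = T.opp (T.next (T.opp (T.next (T.opp d)))) ∧
      T.IsStarAt (T.next (T.next (T.opp d))) t r := by
  constructor
  · rintro ⟨L, hleaf, hspokes⟩
    rcases hspokes with _ | @⟨x, _, L, _, hx, hspokes⟩
    simp only [leafDarts, starSides, List.flatMap_cons, List.cons_append, List.nil_append,
      List.cons.injEq] at hleaf
    obtain ⟨rfl, hsnd, hleaf⟩ := hleaf
    exact ⟨hx, hsnd, L, hleaf, hspokes⟩
  · rintro ⟨hx, hsnd, L, hleaf, hspokes⟩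
    refine ⟨_ :: L, ?_, .cons hx hspokes⟩
    simp only [leafDarts, hsnd, hleaf, starSides, List.flatMap_cons, List.cons_append,
      List.nil_append]

theorem of_mul_of_mul (h : T.IsStarAt d (of a * (of b * t)) (w :: r)) :
    T.IsSpoke (T.next (T.opp d)) w ∧
      T.opp (T.next (T.next (T.opp d))) = T.next (T.next (T.opp (T.next (T.opp d)))) ∧
      T.IsStarAt (T.next (T.opp (T.next (T.opp d)))) t r := by
  obtain ⟨L, hleaf, hspokes⟩ := h
  rcases hspokes with _ | @⟨x, _, L, _, hx, hspokes⟩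
  simp only [leafDarts, starSides, List.flatMap_cons, List.cons_append, List.nil_append,
    List.cons.injEq] at hleaf
  obtain ⟨rfl, hturn, hleaf⟩ := hleaf
  rw [← hturn, T.next_next_next]
  exact ⟨hx, rfl, L, hleaf, hspokes⟩

theorem mul_of_mul_of (h : T.IsStarAt (T.next (T.opp (T.next (T.opp d)))) t r)
    (hnew : T.opp (T.next (T.next (T.opp d))) = T.next (T.next (T.opp (T.next (T.opp d)))))
    (hspoke : T.IsSpoke (T.opp (T.next (T.next (T.opp d)))) w) :
    T.IsStarAt d (t * of a * of b) (r ++ [w]) := by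
  obtain ⟨L, hleaf, hspokes⟩ := h
  refine ⟨_, ?_, List.rel_append hspokes (.cons hspoke .nil)⟩
  simp only [leafDarts, hleaf, ← hnew, starSides, List.flatMap_append, List.flatMap_singleton,
    T.opp_opp, List.append_assoc, List.singleton_append]

end IsStarAt

theorem isStarAt_afterShape (T : Triangulation n D) (p : Fin n → Bool) (v : Fin n)
    (l : List (Fin n)) {d : D} (hd : T.vert (T.opp d) = none)
    (h : T.IsStarAt d (beforeShape (l.map p)) (l ++ [v])) :
    T.IsStarAt d (afterShape (l.map p)) (pass p (l ++ [v])) ∧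
      darts T.next T.opp d (afterShape (l.map p)) =
        darts T.next T.opp d (beforeShape (l.map p)) := by
  induction l generalizing d with
  | nil =>
    rw [List.nil_append] at h ⊢
    exact ⟨by rwa [pass_singleton], rfl⟩
  | cons w l ih =>
    rw [List.map_cons, List.cons_append] at h ⊢
    rw [pass_cons]
    cases hp : p w with
    | true =>
      rw [hp] at h
      obtain ⟨hspoke, hnew, h⟩ := h.of_mul_of_mul
      have hvert : T.vert (T.opp (T.next (T.next (T.opp d)))) = none := by
        rw [← T.vert_next, T.next_next_next, hd]
      obtain ⟨h, hdarts⟩ := ih (by rw [← T.vert_next, ← hnew, hvert]) h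
      refine ⟨h.mul_of_mul_of hnew ⟨hvert, ?_⟩, ?_⟩
      · rw [T.opp_opp, T.vert_next, hspoke.2]
      · simp only [beforeShape, afterShape, darts, hdarts, hnew, T.next_next_next]
        abel
    | false =>
      rw [hp] at h
      obtain ⟨hspoke, hpair, h⟩ := IsStarAt.pair_mul_iff.1 h
      obtain ⟨h, hdarts⟩ := ih (by rwa [← T.vert_next, T.next_next_next]) h
      refine ⟨IsStarAt.pair_mul_iff.2 ⟨hspoke, hpair, h⟩, ?_⟩
      simp only [beforeShape, afterShape, darts, hdarts]

theorem IsStar.pass {T : Triangulation n D} {p : Fin n → Bool} {l : List (Fin n)} {v : Fin n}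
    (h : T.IsStar (beforeShape (l.map p)) (l ++ [v])) :
    T.IsStar (afterShape (l.map p)) (pass p (l ++ [v])) := by
  obtain ⟨hT, hstar⟩ := h
  have hroot : T.vert (T.opp T.root) = none := by rw [← T.vert_next, T.next_root, T.vert_root]
  obtain ⟨hstar, hdarts⟩ := T.isStarAt_afterShape p v l hroot hstar
  exact ⟨⟨hdarts ▸ hT.nodup, hdarts ▸ hT.mem⟩, hstar⟩

end Triangulation

/-! ### Distances in the flip graph -/

section Distance

variable (s : Setoid (Tri n)) {m : ℕ} {T T' : Triangulation n (Fin m)} {t t' : FreeMagma α}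
  {r : List (Fin n)}

theorem FlipAlong.edist_le_one {S : Set (Fin m)} (h : FlipAlong S T T') :
    (flipGraph s).edist ⟦⟨m, T⟩⟧ ⟦⟨m, T'⟩⟧ ≤ 1 := by
  by_cases heq : (⟦⟨m, T⟩⟧ : Quotient s) = ⟦⟨m, T'⟩⟧
  · rw [heq, SimpleGraph.edist_self]
    exact zero_le
  · have hadj : (flipGraph s).Adj ⟦⟨m, T⟩⟧ ⟦⟨m, T'⟩⟧ :=
      ⟨heq, .inl ⟨m, S, T, T', h, rfl, rfl⟩⟩
    exact (SimpleGraph.edist_eq_one_iff_adj.2 hadj).le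

namespace Triangulation

theorem Develops.exists_edist_le {k : ℕ} (hT : T.Develops t) (h : SimRots k t t') :
    ∃ T' : Triangulation n (Fin m), T'.Develops t' ∧ T'.opp = T.opp ∧ T'.sides t' = T.sides t ∧
      (∀ d ∈ T.sides t, T'.vert d = T.vert d) ∧
      (flipGraph s).edist ⟦⟨m, T⟩⟧ ⟦⟨m, T'⟩⟧ ≤ k := by
  induction k generalizing T t with
  | zero =>
    obtain rfl : t = t' := h
    exact ⟨T, hT, rfl, rfl, fun _ _ => rfl, by simp⟩
  | succ k ih =>
    obtain ⟨u, hrot, hrots⟩ := h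
    obtain ⟨S, T₁, hflip, hT₁, hsides₁, hvert₁⟩ := hT.exists_flipAlong hrot
    obtain ⟨T₂, hT₂, hopp, hsides, hvert, hdist⟩ := ih hT₁ hrots
    refine ⟨T₂, hT₂, hopp.trans hflip.2.2.1, hsides.trans hsides₁, fun d hd => ?_, ?_⟩
    · rw [hvert d (hsides₁ ▸ hd), hvert₁ d hd]
    · rw [Nat.cast_succ, add_comm]
      exact SimpleGraph.edist_triangle.trans (add_le_add (hflip.edist_le_one s) hdist)

theorem IsStar.exists_edist_le {k : ℕ} (hT : T.IsStar t r)
    (h : SimRots k t t') : ∃ T' : Triangulation n (Fin m), T'.IsStar t' r ∧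
      (flipGraph s).edist ⟦⟨m, T⟩⟧ ⟦⟨m, T'⟩⟧ ≤ k := by
  obtain ⟨hT, L, hleaf, hspokes⟩ := hT
  obtain ⟨T', hT', hopp, hsides, hvert, hdist⟩ := hT.exists_edist_le s h
  rw [sides, sides, hleaf] at hsides
  rw [sides, hleaf] at hvert
  refine ⟨T', ⟨hT', L, hopp ▸ hsides, ?_⟩, hdist⟩
  refine List.forall₂_iff_get.2 ⟨hspokes.length_eq, fun i hi hi' => ?_⟩
  have hmem : L.get ⟨i, hi⟩ ∈ L := List.get_mem _ _
  have hspoke := (List.forall₂_iff_get.1 hspokes).2 i hi hi'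
  rw [IsSpoke, hopp, hvert _ ((mem_starSides T.opp_opp).2 (.inl hmem)),
    hvert _ ((mem_starSides T.opp_opp).2 (.inr (by rwa [T.opp_opp])))]
  exact hspoke

theorem exists_isStar_edist_le {j : ℕ} (hj : 2 * n * 5 ^ j ≤ 6 ^ j)
    (T : Triangulation n (Fin m)) :
    ∃ (T' : Triangulation n (Fin m)) (t : FreeMagma Unit) (r : List (Fin n)), T'.IsStar t r ∧
      r.Perm (List.finRange n) ∧ (flipGraph s).edist ⟦⟨m, T⟩⟧ ⟦⟨m, T'⟩⟧ ≤ (3 * j : ℕ) := by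
  obtain ⟨t, hT⟩ := T.exists_develops_empty
  obtain ⟨T', hT', -, -, -, hdist⟩ := hT.exists_edist_le s
    (simRots_comb j t (by rwa [hT.length_eq]))
  have hroot : T'.vert (T'.opp T'.root) = none := by
    rw [← T'.vert_next, T'.next_root, T'.vert_root]
  obtain ⟨t', r, hstar, hr⟩ := T'.exists_isStar fun x =>
    T'.vert_adjacent_of_mem_darts_comb _ hroot x (hT'.mem x)
  exact ⟨T', t', r, hstar, hr, hdist⟩

theorem IsStar.exists_edist_le_of_length_eq [Subsingleton α] {j : ℕ} (hj : 2 * n * 5 ^ j ≤ 6 ^ j)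
    (hT : T.IsStar t r) (ht' : t'.length = 2 * n) :
    ∃ T' : Triangulation n (Fin m), T'.IsStar t' r ∧
      (flipGraph s).edist ⟦⟨m, T⟩⟧ ⟦⟨m, T'⟩⟧ ≤ (6 * j : ℕ) := by
  have ht := hT.1.length_eq
  exact hT.exists_edist_le s (simRots_of_toFreeSemigroup_eq j t t'
    (toFreeSemigroup_eq_of_length_eq (ht.trans ht'.symm)) (by rwa [ht]))

theorem IsStar.exists_isStar_pass {j : ℕ} (hj : 2 * n * 5 ^ j ≤ 6 ^ j) {t : FreeMagma Unit}
    (hT : T.IsStar t r) (p : Fin n → Bool) :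
    ∃ (T' : Triangulation n (Fin m)) (t' : FreeMagma Unit), T'.IsStar t' (FlipDisk.pass p r) ∧
      (flipGraph s).edist ⟦⟨m, T⟩⟧ ⟦⟨m, T'⟩⟧ ≤ (6 * j : ℕ) := by
  have hr := hT.length_eq
  have hpos : 0 < r.length := by
    have := t.length_pos
    rw [hT.1.length_eq] at this
    omega
  obtain ⟨l, v, rfl⟩ := (List.eq_nil_or_concat' r).resolve_left (List.ne_nil_of_length_pos hpos)
  rw [List.length_append, List.length_singleton] at hr
  obtain ⟨T', hT', hdist⟩ := hT.exists_edist_le_of_length_eq s hj (t' := beforeShape (l.map p))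
    (by rw [length_beforeShape, List.length_map, hr])
  exact ⟨T', _, hT'.pass, hdist⟩

theorem exists_isStar_radix {j : ℕ} (hj : 2 * n * 5 ^ j ≤ 6 ^ j)
    (T : Triangulation n (Fin m)) (k : ℕ) :
    ∃ (T' : Triangulation n (Fin m)) (t : FreeMagma Unit) (r : List (Fin n)),
      T'.IsStar t (radix k r) ∧ r.Perm (List.finRange n) ∧
      (flipGraph s).edist ⟦⟨m, T⟩⟧ ⟦⟨m, T'⟩⟧ ≤ (3 * j + 6 * j * k : ℕ) := by
  induction k with
  | zero => simpa only [radix, mul_zero, add_zero] using exists_isStar_edist_le s hj T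
  | succ k ih =>
    obtain ⟨T', t, r, hT', hr, hdist⟩ := ih
    obtain ⟨T'', t', hT'', hdist'⟩ := hT'.exists_isStar_pass s hj fun w => w.val.testBit k
    refine ⟨T'', t', r, hT'', hr, ?_⟩
    calc (flipGraph s).edist ⟦⟨m, T⟩⟧ ⟦⟨m, T''⟩⟧
        ≤ (3 * j + 6 * j * k : ℕ) + (6 * j : ℕ) :=
          SimpleGraph.edist_triangle.trans (add_le_add hdist hdist')
      _ = (3 * j + 6 * j * (k + 1) : ℕ) := by rw [← Nat.cast_add]; ring_nf

end Triangulation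

open Triangulation

theorem flipGraph_edist_le (hs : orientedSetoid n ≤ s) {j k : ℕ}
    (hj : 2 * n * 5 ^ j ≤ 6 ^ j) (hk : n ≤ 2 ^ k) (X Y : Quotient s) :
    (flipGraph s).edist X Y ≤ (12 * j * (k + 1) : ℕ) := by
  obtain ⟨⟨m, T⟩, rfl⟩ := Quotient.exists_rep X
  obtain ⟨⟨m', T'⟩, rfl⟩ := Quotient.exists_rep Y
  obtain ⟨T₁, t, r, hT₁, hr, hdist⟩ := exists_isStar_radix s hj T k
  obtain ⟨T₁', t', r', hT₁', hr', hdist'⟩ := exists_isStar_radix s hj T' k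
  obtain ⟨T₂, hT₂, hdist₂⟩ := hT₁.exists_edist_le_of_length_eq s hj hT₁'.1.length_eq
  rw [radix_eq_of_perm hk (hr.trans hr'.symm)] at hT₂
  have hclass : (⟦⟨m, T₂⟩⟧ : Quotient s) = ⟦⟨m', T₁'⟩⟧ :=
    Quotient.sound (hs (hT₂.orientedIso hT₁'))
  rw [hclass] at hdist₂
  rw [SimpleGraph.edist_comm] at hdist'
  calc (flipGraph s).edist ⟦⟨m, T⟩⟧ ⟦⟨m', T'⟩⟧
      ≤ (3 * j + 6 * j * k : ℕ) + (6 * j : ℕ) + (3 * j + 6 * j * k : ℕ) :=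
        SimpleGraph.edist_triangle.trans (add_le_add
          (SimpleGraph.edist_triangle.trans (add_le_add hdist hdist₂)) hdist')
    _ = (12 * j * (k + 1) : ℕ) := by rw [← Nat.cast_add, ← Nat.cast_add]; ring_nf

theorem two_pow_clog_succ_le (hn : 1 ≤ n) : 2 ^ (Nat.clog 2 n + 1) ≤ (n + 1) ^ 2 := by
  obtain rfl | hlt := hn.eq_or_lt
  · simp
  have hpos := Nat.clog_pos one_lt_two hlt
  have hpred := Nat.pow_pred_clog_lt_self one_lt_two hlt
  rw [Nat.pred_eq_sub_one] at hpred
  rw [show Nat.clog 2 n + 1 = Nat.clog 2 n - 1 + 2 by omega, pow_add]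
  nlinarith

theorem two_mul_mul_five_pow_le {k : ℕ} (hk : n ≤ 2 ^ k) :
    2 * n * 5 ^ (4 * (k + 1)) ≤ 6 ^ (4 * (k + 1)) :=
  calc 2 * n * 5 ^ (4 * (k + 1)) ≤ 2 ^ (k + 1) * 5 ^ (4 * (k + 1)) :=
        Nat.mul_le_mul_right _ (by rw [pow_succ]; omega)
    _ = (2 * 5 ^ 4) ^ (k + 1) := by rw [pow_mul, mul_pow]
    _ ≤ (6 ^ 4) ^ (k + 1) := Nat.pow_le_pow_left (by norm_num) _
    _ = 6 ^ (4 * (k + 1)) := (pow_mul _ _ _).symm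

theorem clog_succ_sq_lt (hn : 1 ≤ n) :
    48 * ((Nat.clog 2 n : ℝ) + 1) ^ 2 < 1000 * Real.log ((n : ℝ) + 1) ^ 2 := by
  set k := Nat.clog 2 n
  have hpow : (2 : ℝ) ^ (k + 1) ≤ ((n : ℝ) + 1) ^ 2 := by exact_mod_cast two_pow_clog_succ_le hn
  have hlog : ((k : ℝ) + 1) * Real.log 2 ≤ 2 * Real.log ((n : ℝ) + 1) := by
    have := Real.log_le_log (by positivity) hpow
    rwa [Real.log_pow, Real.log_pow, Nat.cast_succ, Nat.cast_two] at this
  have hlinear : ((k : ℝ) + 1) / 3 ≤ Real.log ((n : ℝ) + 1) := by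
    nlinarith [Real.log_two_gt_d9, k.cast_nonneg (α := ℝ)]
  have hsq := pow_le_pow_left₀ (by positivity) hlinear 2
  nlinarith [k.cast_nonneg (α := ℝ)]

end Distance

end FlipDisk

theorem theorem3p1_general (n : ℕ) (hn : 1 ≤ n) (s : Setoid (FlipDisk.Tri n))
    (hs : FlipDisk.orientedSetoid n ≤ s) :
    (FlipDisk.flipGraph s).Connected ∧ (FlipDisk.flipGraph s).ediam ≠ ⊤ ∧
      ((FlipDisk.flipGraph s).diam : ℝ) < 1000 * (Real.log ((n : ℝ) + 1)) ^ 2 := by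
  set k := Nat.clog 2 n
  have hk : n ≤ 2 ^ k := Nat.le_pow_clog one_lt_two n
  have hdist := FlipDisk.flipGraph_edist_le s hs (FlipDisk.two_mul_mul_five_pow_le hk) hk
  have hediam := SimpleGraph.ediam_le_of_edist_le hdist
  refine ⟨?_, ne_top_of_le_ne_top (ENat.natCast_ne_top _) hediam, ?_⟩
  · have : Nonempty (Quotient s) := (FlipDisk.nonempty_tri n hn).map (Quotient.mk s)
    exact ⟨fun X Y => SimpleGraph.edist_ne_top_iff_reachable.1
      (ne_top_of_le_ne_top (ENat.natCast_ne_top _) (hdist X Y))⟩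
  · have hdiam : (FlipDisk.flipGraph s).diam ≤ 12 * (4 * (k + 1)) * (k + 1) :=
      ENat.toNat_le_of_le_natCast hediam
    calc ((FlipDisk.flipGraph s).diam : ℝ) ≤ (12 * (4 * (k + 1)) * (k + 1) : ℕ) := by
          exact_mod_cast hdiam
      _ = 48 * ((k : ℝ) + 1) ^ 2 := by push_cast; ring
      _ < 1000 * Real.log ((n : ℝ) + 1) ^ 2 := FlipDisk.clog_succ_sq_lt hn

theorem theorem3p1 (n : ℕ) (hn : 1 ≤ n) :
    ((FlipDisk.modularFlipGraph n).Connected ∧ (FlipDisk.modularFlipGraph n).ediam ≠ ⊤ ∧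
      ((FlipDisk.modularFlipGraph n).diam : ℝ) < 1000 * (Real.log ((n : ℝ) + 1)) ^ 2) ∧
    ((FlipDisk.orientedModularFlipGraph n).Connected ∧
      (FlipDisk.orientedModularFlipGraph n).ediam ≠ ⊤ ∧
      ((FlipDisk.orientedModularFlipGraph n).diam : ℝ) <
        1000 * (Real.log ((n : ℝ) + 1)) ^ 2) :=
  ⟨theorem3p1_general n hn (FlipDisk.homeoSetoid n) fun _ _ => .inl,
    theorem3p1_general n hn (FlipDisk.orientedSetoid n) le_rfl⟩
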